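/- For a set $T$ let $\ell^\infty(T)$ be the space of bounded functions $T\to\mathbb R$ with the supremum norm. For a probability space $(\Omega,P)$ and bounded $f:\Omega\to\mathbb R$ let $E^*[f]=\inf\{E[U]: U\ge f,\ U \text{ measurable and integrable}\}$ and $E_*[f]=-E^*[-f]$ be the outer and inner expectation, and let $P^*$ be outer probability. For maps $X_n$, $Y_n$ (not necessarily measurable) from probability spaces, which may depend on $n$, into a metric space $D$: - $X_n$ converges weakly to a Borel probability law $L$ on $D$ if $E^*[f(X_n)]\to\int f\,dL$ for all bounded continuous $f:D\to\mathbb R$; $X_n$ is *relatively compact* if every subsequence has a further subsequence that converges weakly to a tight Borel probability law; - $X_n$ is *asymptotically measurable* if $E^*[f(X_n)]-E_*[f(X_n)]\to0$ for all bounded continuous $f:D\to\mathbb R$; - $X_n\leftrightarrow_d Y_n$ (*relative weak convergence*) if $|E^*[f(X_n)]-E^*[f(Y_n)]|\to0$ for all bounded continuous $f:D\to\mathbb R$. Let $\mathbb X_n$ be a random variable with values in a measurable space $\mathcal X_n$, defined on a probability space $(\Omega_n,P_n)$, and $\mathbb V_n$ a random variable with values in a measurable space $\mathcal V_n$, defined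 on a probability space $(\Omega_n',Q_n)$. As usual for non-measurable maps, independence is understood through product spaces: on $\Omega_n\times\Omega_n'\times\Omega_n'$ with the measure $P_n\otimes Q_n\otimes Q_n$, the data are $\mathbb X_n(\omega)$ and the two independent copies of $\mathbb V_n$, independent of $\mathbb X_n$, are $\mathbb V_n^{(1)}=\mathbb V_n(\omega_1)$ and $\mathbb V_n^{(2)}=\mathbb V_n(\omega_2)$ at the point $(\omega,\omega_1,\omega_2)$. Let $\mathbb G_n=\mathbb G_n(\mathbb X_n)$ and $\mathbb G_n^{(j)}=\mathbb G_n^{b}(\mathbb X_n,\mathbb V_n^{(j)})$, $j=1,2$, be maps with values in $\ell^\infty(T)$ constructed from $\mathbb X_n$ and from $(\mathbb X_n,\mathbb V_n^{(j)})$, such that $\mathbb G_n(t)$ and $\mathbb G_n^{(j)}(t)$ are measurable for each $t\in T$. Let $\mathbb G_n^{\otimes 3}$ be the map $(\omega,\omega',\omega'')\mapsto(\mathbb G_n(\omega),\mathbb G_n(\omega'),\mathbb G_n(\omega''))$ on $\Omega_n^3$ with the measure $P_n^{\otimes3}$, that is, three independent copies of $\mathbb G_n$. Let $\mathrm{BL}_1$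 be the set of functions $h:\ell^\infty(T)\to\mathbb R$ with $|h|\le1$ and $|h(x)-h(y)|\le\|x-y\|$ for all $x,y$, and let $E^*[h(\mathbb G_n^{(1)})\mid\mathbb X_n]$ denote the outer expectation with respect to $\omega_1$ (under $Q_n$) for fixed $\omega$. **Proposition.** Assume that $\mathbb G_n$ is relatively compact. Then the following are equivalent: (a) as $n\to\infty$, $$\sup_{h\in\mathrm{BL}_1}\bigl|E^*[h(\mathbb G_n^{(1)})\mid\mathbb X_n]-E^*[h(\mathbb G_n)]\bigr|\to0\quad\text{in outer probability,}$$ and $\mathbb G_n^{(1)}$ is asymptotically measurable; (b) $(\mathbb G_n,\mathbb G_n^{(1)},\mathbb G_n^{(2)})\leftrightarrow_d\mathbb G_n^{\otimes3}$ in $\ell^\infty(T)^3$. -/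

import Mathlib

open MeasureTheory Filter Topology
open scoped BoundedContinuousFunction

noncomputable section

/-- The space `ℓ^∞(T)` of bounded real functions on `T`, with the supremum norm. -/
abbrev LInf (T : Type*) : Type _ := lp (fun _ : T => ℝ) (⊤ : ENNReal)

/-- `ℓ^∞(T)` carries its Borel `σ`-algebra. -/
instance LInf.instMeasurableSpace (T : Type*) : MeasurableSpace (LInf T) := borel _

instance LInf.instBorelSpace (T : Type*) : BorelSpace (LInf T) := ⟨rfl⟩

/-- Outer expectation `E^*[f]` of a bounded, not necessarily measurable, function `f` on a
probability space: the infimum of `E[U]` over all measurable integrable `U ≥ f`. -/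
def outerExp {Ω : Type*} [MeasurableSpace Ω] (P : Measure Ω) (f : Ω → ℝ) : ℝ :=
  sInf {c : ℝ | ∃ U : Ω → ℝ, Measurable U ∧ Integrable U P ∧ (∀ ω, f ω ≤ U ω) ∧ c = ∫ ω, U ω ∂P}

/-- Inner expectation `E_*[f] = -E^*[-f]`. -/
def innerExp {Ω : Type*} [MeasurableSpace Ω] (P : Measure Ω) (f : Ω → ℝ) : ℝ :=
  -outerExp P (fun ω => -f ω)

/-- Weak convergence (in the sense of Hoffmann-Jørgensen) of a sequence of arbitrary maps
`X n : Ω n → D` to the Borel law `L`. -/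
def WeaklyConverges {D : Type*} [TopologicalSpace D] [MeasurableSpace D]
    {Ω : ℕ → Type*} [∀ n, MeasurableSpace (Ω n)]
    (P : ∀ n, Measure (Ω n)) (X : ∀ n, Ω n → D) (L : Measure D) : Prop :=
  ∀ f : D →ᵇ ℝ, Tendsto (fun n => outerExp (P n) (fun ω => f (X n ω))) atTop (𝓝 (∫ x, f x ∂L))

/-- `X n` is relatively compact: every subsequence has a further subsequence that converges
weakly to a tight Borel probability law. -/
def RelativelyCompact {D : Type*} [TopologicalSpace D] [MeasurableSpace D]
    {Ω : ℕ → Type*} [∀ n, MeasurableSpace (Ω n)]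
    (P : ∀ n, Measure (Ω n)) (X : ∀ n, Ω n → D) : Prop :=
  ∀ φ : ℕ → ℕ, StrictMono φ → ∃ ψ : ℕ → ℕ, StrictMono ψ ∧
    ∃ L : Measure D, IsProbabilityMeasure L ∧ IsTightMeasureSet {L} ∧
      WeaklyConverges (fun k => P (φ (ψ k))) (fun k => X (φ (ψ k))) L

/-- `X n` is asymptotically measurable. -/
def AsymptoticallyMeasurable {D : Type*} [TopologicalSpace D]
    {Ω : ℕ → Type*} [∀ n, MeasurableSpace (Ω n)]
    (P : ∀ n, Measure (Ω n)) (X : ∀ n, Ω n → D) : Prop :=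
  ∀ f : D →ᵇ ℝ, Tendsto
    (fun n => outerExp (P n) (fun ω => f (X n ω)) - innerExp (P n) (fun ω => f (X n ω)))
    atTop (𝓝 0)

/-- `X n` and `Y n` are relatively weakly convergent, `X n ↔_d Y n`. -/
def RelativelyWeaklyConvergent {D : Type*} [TopologicalSpace D]
    {Ω Ω' : ℕ → Type*} [∀ n, MeasurableSpace (Ω n)] [∀ n, MeasurableSpace (Ω' n)]
    (P : ∀ n, Measure (Ω n)) (X : ∀ n, Ω n → D)
    (Q : ∀ n, Measure (Ω' n)) (Y : ∀ n, Ω' n → D) : Prop :=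
  ∀ f : D →ᵇ ℝ, Tendsto
    (fun n => |outerExp (P n) (fun ω => f (X n ω)) - outerExp (Q n) (fun ω => f (Y n ω))|)
    atTop (𝓝 0)

/-- `BL_1(D)`: the functions `D → ℝ` that are `1`-Lipschitz and bounded by `1`. -/
def BL1 (D : Type*) [PseudoMetricSpace D] : Set (D → ℝ) :=
  {h | LipschitzWith 1 h ∧ ∀ x, |h x| ≤ 1}

/-- The bounded-Lipschitz distance `sup_{h ∈ BL_1(D)} |E^*[h(X)] - E^*[h(Y)]|` of two arbitrary
maps into `D`; all the terms are at most `2` when `P` and `Q` are probability measures. -/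
def boundedLipschitzDist {D : Type*} [PseudoMetricSpace D]
    {Ω Ω' : Type*} [MeasurableSpace Ω] [MeasurableSpace Ω']
    (P : Measure Ω) (X : Ω → D) (Q : Measure Ω') (Y : Ω' → D) : ℝ :=
  ⨆ h : BL1 D, |outerExp P (fun ω => h.1 (X ω)) - outerExp Q (fun ω => h.1 (Y ω))|

/-- Convergence to `0` in outer probability of arbitrary real maps `Z n : Ω n → ℝ` (the value of a
`Measure` on an arbitrary set is its outer measure). -/
def TendstoZeroInOuterProb {Ω : ℕ → Type*} [∀ n, MeasurableSpace (Ω n)]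
    (P : ∀ n, Measure (Ω n)) (Z : ∀ n, Ω n → ℝ) : Prop :=
  ∀ ε : ℝ, 0 < ε → Tendsto (fun n => P n {ω | ε < |Z n ω|}) atTop (𝓝 0)

end

/-!
Arbitrary maps are handled through the seminorm `f ↦ max (E^*[f]) (E^*[-f])`: where it is small at
`f - c`, the mean of `f` is close to `c` and `f` is close to a measurable function, so that Fubini
arguments for measurable functions carry over up to a controlled error.

Two copies of the bootstrap statistic which are independent given the data turn the second moment of
a conditional mean into an unconditional moment, `E[E[h(G¹) | X]²] = E[h(G¹) h(G²)]`. If the joint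
law is asymptotically that of three independent copies, the variance of the conditional mean of
`h(G¹)` therefore tends to `0`. Conversely, concentration of the conditional means makes the mixed
moments `E[f(G) g(G¹) h(G²)]` factorise in the limit.

To pass between single test functions and the supremum over `BL_1`, or all bounded continuous
functions on the triple product, work along subsequences on which `G` converges to a tight law. On a
compact set carrying nearly all of its mass every test function in question is uniformly
approximated by combinations of finitely many Lipschitz bumps, or of their products.
-/

section Bounded

variable {α β : Type*} {f g : α → ℝ}

/-- Boundedness of a real function in the form needed by `outerExp`, which is only meaningful
for functions that are bounded below. -/
def IsBoundedFun (f : α → ℝ) : Prop := ∃ M, ∀ x, |f x| ≤ M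

namespace IsBoundedFun

lemma const (c : ℝ) : IsBoundedFun fun _ : α => c := ⟨|c|, fun _ => le_rfl⟩

lemma neg (hf : IsBoundedFun f) : IsBoundedFun fun x => -f x :=
  hf.imp fun _ hM x => (abs_neg (f x)).trans_le (hM x)

lemma abs (hf : IsBoundedFun f) : IsBoundedFun fun x => |f x| :=
  hf.imp fun _ hM x => (abs_abs (f x)).trans_le (hM x)

lemma add (hf : IsBoundedFun f) (hg : IsBoundedFun g) : IsBoundedFun fun x => f x + g x := by
  obtain ⟨M, hM⟩ := hf
  obtain ⟨N, hN⟩ := hg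
  exact ⟨M + N, fun x => (abs_add_le _ _).trans (add_le_add (hM x) (hN x))⟩

lemma sub (hf : IsBoundedFun f) (hg : IsBoundedFun g) : IsBoundedFun fun x => f x - g x := by
  simpa only [sub_eq_add_neg] using hf.add hg.neg

lemma mul (hf : IsBoundedFun f) (hg : IsBoundedFun g) : IsBoundedFun fun x => f x * g x := by
  obtain ⟨M, hM⟩ := hf
  obtain ⟨N, hN⟩ := hg
  refine ⟨M * N, fun x => ?_⟩
  rw [abs_mul]
  exact mul_le_mul (hM x) (hN x) (abs_nonneg _) ((abs_nonneg _).trans (hM x))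

lemma sum {ι : Type*} {s : Finset ι} {f : ι → α → ℝ} (hf : ∀ i, IsBoundedFun (f i)) :
    IsBoundedFun fun x => ∑ i ∈ s, f i x := by
  choose M hM using hf
  exact ⟨∑ i ∈ s, M i, fun x =>
    (Finset.abs_sum_le_sum_abs _ _).trans (Finset.sum_le_sum fun i _ => hM i x)⟩

lemma comp (hf : IsBoundedFun f) (k : β → α) : IsBoundedFun fun x => f (k x) :=
  hf.imp fun _ hM x => hM (k x)

lemma bcf {D : Type*} [TopologicalSpace D] (h : D →ᵇ ℝ) (X : α → D) :
    IsBoundedFun fun x => h (X x) :=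
  ⟨‖h‖, fun x => h.norm_coe_le_norm (X x)⟩

lemma integrable [MeasurableSpace α] {P : Measure α} [IsFiniteMeasure P] (hf : IsBoundedFun f)
    (hfm : Measurable f) : Integrable f P :=
  hf.elim fun M hM => .of_bound hfm.aestronglyMeasurable M (.of_forall hM)

end IsBoundedFun

end Bounded

section OuterExpectation

variable {Ω Ω' : Type*} [MeasurableSpace Ω] [MeasurableSpace Ω'] {P : Measure Ω} {Q : Measure Ω'}
  {f g : Ω → ℝ}

section FiniteMeasure

variable [IsFiniteMeasure P] [IsFiniteMeasure Q]

lemma outerExp_le_integral {U : Ω → ℝ} (hf : IsBoundedFun f) (hU : Measurable U)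
    (hUi : Integrable U P) (hfU : ∀ ω, f ω ≤ U ω) : outerExp P f ≤ ∫ ω, U ω ∂P := by
  obtain ⟨M, hM⟩ := hf
  refine csInf_le ⟨∫ _, -M ∂P, ?_⟩ ⟨U, hU, hUi, hfU, rfl⟩
  rintro _ ⟨V, -, hVi, hfV, rfl⟩
  exact integral_mono (integrable_const _) hVi fun ω => (abs_le.1 (hM ω)).1.trans (hfV ω)

/-- The infimum of countably many near-optimal majorants is optimal. -/
lemma exists_measurable_majorant_abs_le {M : ℝ} (hf : ∀ ω, |f ω| ≤ M) :
    ∃ u : Ω → ℝ, Measurable u ∧ (∀ ω, f ω ≤ u ω) ∧ (∀ ω, |u ω| ≤ M) ∧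
      ∫ ω, u ω ∂P = outerExp P f := by
  set S := {c : ℝ | ∃ U : Ω → ℝ, Measurable U ∧ Integrable U P ∧ (∀ ω, f ω ≤ U ω) ∧
    c = ∫ ω, U ω ∂P}
  have hne : S.Nonempty :=
    ⟨_, fun _ => M, measurable_const, integrable_const _, fun ω => (abs_le.1 (hf ω)).2, rfl⟩
  have hbdd : BddBelow S := by
    refine ⟨outerExp P f, ?_⟩
    rintro _ ⟨U, hU, hUi, hfU, rfl⟩
    exact outerExp_le_integral ⟨M, hf⟩ hU hUi hfU
  obtain ⟨c, -, hc, hcS⟩ := exists_seq_tendsto_sInf hne hbdd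
  choose U hUm hUi hfU hcU using hcS
  have hlow : ∀ ω k, f ω ≤ min (U k ω) M := fun ω k => le_min (hfU k ω) (abs_le.1 (hf ω)).2
  have hb : ∀ ω, BddBelow (Set.range fun k => min (U k ω) M) := fun ω =>
    ⟨f ω, Set.forall_mem_range.2 (hlow ω)⟩
  have hum : Measurable fun ω => ⨅ k, min (U k ω) M :=
    .iInf fun k => (hUm k).min measurable_const
  have hfu : ∀ ω, f ω ≤ ⨅ k, min (U k ω) M := fun ω => le_ciInf (hlow ω)
  have huM : ∀ ω, |⨅ k, min (U k ω) M| ≤ M := fun ω => abs_le.2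
    ⟨(abs_le.1 (hf ω)).1.trans (hfu ω), (ciInf_le (hb ω) 0).trans (min_le_right _ _)⟩
  have hui : Integrable (fun ω => ⨅ k, min (U k ω) M) P := IsBoundedFun.integrable ⟨M, huM⟩ hum
  refine ⟨_, hum, hfu, huM, le_antisymm (ge_of_tendsto' hc fun k => ?_)
    (outerExp_le_integral ⟨M, hf⟩ hum hui hfu)⟩
  rw [hcU k]
  exact integral_mono hui (hUi k) fun ω => (ciInf_le (hb ω) k).trans (min_le_left _ _)

lemma IsBoundedFun.exists_measurable_majorant (hf : IsBoundedFun f) :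
    ∃ u : Ω → ℝ, Measurable u ∧ Integrable u P ∧ (∀ ω, f ω ≤ u ω) ∧
      ∫ ω, u ω ∂P = outerExp P f := by
  obtain ⟨M, hM⟩ := hf
  obtain ⟨u, hu, hfu, huM, hui⟩ := exists_measurable_majorant_abs_le (P := P) hM
  exact ⟨u, hu, IsBoundedFun.integrable ⟨M, huM⟩ hu, hfu, hui⟩

lemma outerExp_mono (hf : IsBoundedFun f) (hg : IsBoundedFun g) (h : ∀ ω, f ω ≤ g ω) :
    outerExp P f ≤ outerExp P g := by
  obtain ⟨u, hu, hui, hgu, hint⟩ := hg.exists_measurable_majorant (P := P)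
  exact hint ▸ outerExp_le_integral hf hu hui fun ω => (h ω).trans (hgu ω)

lemma outerExp_eq_integral (hf : IsBoundedFun f) (hfm : Measurable f) :
    outerExp P f = ∫ ω, f ω ∂P := by
  obtain ⟨u, -, hui, hfu, hint⟩ := hf.exists_measurable_majorant (P := P)
  refine (outerExp_le_integral hf hfm (hf.integrable hfm) fun _ => le_rfl).antisymm ?_
  exact hint ▸ integral_mono (hf.integrable hfm) hui hfu

lemma outerExp_nonneg (hf : IsBoundedFun f) (h : ∀ ω, 0 ≤ f ω) : 0 ≤ outerExp P f := by
  simpa [outerExp_eq_integral (P := P) (.const 0) measurable_const] using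
    outerExp_mono (P := P) (.const 0) hf h

lemma outerExp_add_le (hf : IsBoundedFun f) (hg : IsBoundedFun g) :
    outerExp P (fun ω => f ω + g ω) ≤ outerExp P f + outerExp P g := by
  obtain ⟨u, hu, hui, hfu, hu_int⟩ := hf.exists_measurable_majorant (P := P)
  obtain ⟨v, hv, hvi, hgv, hv_int⟩ := hg.exists_measurable_majorant (P := P)
  rw [← hu_int, ← hv_int, ← integral_add hui hvi]
  exact outerExp_le_integral (hf.add hg) (hu.add hv) (hui.add hvi)
    fun ω => add_le_add (hfu ω) (hgv ω)

lemma outerExp_sum_le {ι : Type*} (s : Finset ι) {f : ι → Ω → ℝ}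
    (hf : ∀ i, IsBoundedFun (f i)) :
    outerExp P (fun ω => ∑ i ∈ s, f i ω) ≤ ∑ i ∈ s, outerExp P (f i) := by
  classical
  induction s using Finset.induction_on with
  | empty => simp [outerExp_eq_integral (P := P) (.const 0) measurable_const]
  | insert i s hi ih =>
    simp only [Finset.sum_insert hi]
    exact (outerExp_add_le (hf i) (.sum hf)).trans (add_le_add le_rfl ih)

lemma outerExp_const_mul_le {r : ℝ} (hr : 0 ≤ r) (hf : IsBoundedFun f) :
    outerExp P (fun ω => r * f ω) ≤ r * outerExp P f := by
  obtain ⟨u, hu, hui, hfu, hint⟩ := hf.exists_measurable_majorant (P := P)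
  rw [← hint, ← integral_const_mul]
  exact outerExp_le_integral ((IsBoundedFun.const r).mul hf) (hu.const_mul r) (hui.const_mul r)
    fun ω => mul_le_mul_of_nonneg_left (hfu ω) hr

lemma outerExp_const_mul {r : ℝ} (hr : 0 < r) (hf : IsBoundedFun f) :
    outerExp P (fun ω => r * f ω) = r * outerExp P f := by
  refine (outerExp_const_mul_le hr.le hf).antisymm ?_
  have h := outerExp_const_mul_le (P := P) (inv_nonneg.2 hr.le) ((IsBoundedFun.const r).mul hf)
  simp only [inv_mul_cancel_left₀ hr.ne'] at h
  rwa [le_inv_mul_iff₀ hr] at h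

lemma outerExp_comp_le {π : Ω → Ω'} (hπ : MeasurePreserving π P Q) {f : Ω' → ℝ}
    (hf : IsBoundedFun f) : outerExp P (fun ω => f (π ω)) ≤ outerExp Q f := by
  obtain ⟨u, hu, hui, hfu, hint⟩ := hf.exists_measurable_majorant (P := Q)
  have hmap : ∫ ω, u (π ω) ∂P = ∫ ω, u ω ∂Q := by
    rw [← hπ.map_eq, integral_map hπ.measurable.aemeasurable hu.aestronglyMeasurable]
  rw [← hint, ← hmap]
  exact outerExp_le_integral (hf.comp π) (hu.comp hπ.measurable)
    (hπ.integrable_comp_of_integrable hui) fun ω => hfu (π ω)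

lemma innerExp_le_outerExp (hf : IsBoundedFun f) : innerExp P f ≤ outerExp P f := by
  have h := (outerExp_nonneg (P := P) (.const 0) fun _ => le_rfl).trans
    ((outerExp_mono (.const 0) (hf.add hf.neg) fun ω => by simp).trans
      (outerExp_add_le (P := P) hf hf.neg))
  rw [innerExp]
  linarith

lemma exists_measurable_approx {M : ℝ} (hf : ∀ ω, |f ω| ≤ M) :
    ∃ u : Ω → ℝ, Measurable u ∧ (∀ ω, |u ω| ≤ M) ∧
      outerExp P (fun ω => |f ω - u ω|) ≤ outerExp P f - innerExp P f := by
  obtain ⟨u, hu, hfu, huM, hint⟩ := exists_measurable_majorant_abs_le (P := P) hf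
  have hfb : IsBoundedFun f := ⟨M, hf⟩
  have hub : IsBoundedFun u := ⟨M, huM⟩
  refine ⟨u, hu, huM, ?_⟩
  calc outerExp P (fun ω => |f ω - u ω|)
      = outerExp P (fun ω => u ω + -f ω) := by
        simp only [← sub_eq_add_neg, abs_of_nonpos (sub_nonpos.2 (hfu _)), neg_sub]
    _ ≤ outerExp P u + outerExp P (fun ω => -f ω) := outerExp_add_le hub hfb.neg
    _ = outerExp P f - innerExp P f := by
        rw [outerExp_eq_integral hub hu, hint, innerExp, sub_neg_eq_add]

end FiniteMeasure

section ProbabilityMeasure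

variable [IsProbabilityMeasure P]

lemma outerExp_const (c : ℝ) : outerExp P (fun _ => c) = c := by
  simp [outerExp_eq_integral (P := P) (.const c) measurable_const]

lemma outerExp_const_add (c : ℝ) (hf : IsBoundedFun f) :
    outerExp P (fun ω => c + f ω) = c + outerExp P f := by
  refine ((outerExp_add_le (.const c) hf).trans_eq (by rw [outerExp_const])).antisymm ?_
  have h := outerExp_add_le (P := P) (.const (-c)) ((IsBoundedFun.const c).add hf)
  simp only [outerExp_const, neg_add_cancel_left] at h
  linarith

lemma outerExp_sub_const (c : ℝ) (hf : IsBoundedFun f) :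
    outerExp P (fun ω => f ω - c) = outerExp P f - c := by
  simpa only [sub_eq_neg_add] using outerExp_const_add (-c) hf

lemma abs_outerExp_le {M : ℝ} (hf : ∀ ω, |f ω| ≤ M) : |outerExp P f| ≤ M := by
  have hfb : IsBoundedFun f := ⟨M, hf⟩
  refine abs_le.2 ⟨?_, ?_⟩
  · simpa only [outerExp_const] using
      outerExp_mono (P := P) (.const (-M)) hfb fun ω => (abs_le.1 (hf ω)).1
  · simpa only [outerExp_const] using
      outerExp_mono (P := P) hfb (.const M) fun ω => (abs_le.1 (hf ω)).2

omit [MeasurableSpace Ω] in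
lemma IsBoundedFun.outerExp_section [IsProbabilityMeasure Q] {f : Ω × Ω' → ℝ}
    (hf : IsBoundedFun f) : IsBoundedFun fun ω => outerExp Q fun ω' => f (ω, ω') :=
  hf.imp fun _ hM _ => abs_outerExp_le fun _ => hM _

/-- The measurability content of Fubini's theorem is needed only for the majorant. -/
lemma outerExp_outerExp_le [IsProbabilityMeasure Q] {f : Ω × Ω' → ℝ} (hf : IsBoundedFun f) :
    outerExp P (fun ω => outerExp Q fun ω' => f (ω, ω')) ≤ outerExp (P.prod Q) f := by
  obtain ⟨M, hM⟩ := hf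
  obtain ⟨u, hu, hfu, huM, hint⟩ := exists_measurable_majorant_abs_le (P := P.prod Q) hM
  have hub : IsBoundedFun u := ⟨M, huM⟩
  have hui := hub.integrable (P := P.prod Q) hu
  rw [← hint, integral_prod _ hui]
  refine outerExp_le_integral (IsBoundedFun.outerExp_section ⟨M, hM⟩)
    hu.stronglyMeasurable.integral_prod_right'.measurable hui.integral_prod_left fun ω => ?_
  have hus : Measurable fun ω' => u (ω, ω') := hu.comp measurable_prodMk_left
  exact outerExp_le_integral ⟨M, fun ω' => hM _⟩ hus ((hub.comp _).integrable hus) fun ω' => hfu _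

lemma outerExp_comp_fst [IsProbabilityMeasure Q] (hf : IsBoundedFun f) :
    outerExp (P.prod Q) (fun p => f p.1) = outerExp P f := by
  refine (outerExp_comp_le measurePreserving_fst hf).antisymm ?_
  simpa only [outerExp_const] using outerExp_outerExp_le (P := P) (Q := Q) (hf.comp Prod.fst)

lemma measure_lt_abs_le {ε : ℝ} (hε : 0 < ε) (hf : IsBoundedFun f) :
    P {ω | ε < |f ω|} ≤ ENNReal.ofReal (outerExp P (fun ω => |f ω|) / ε) := by
  obtain ⟨u, -, hui, hfu, hint⟩ := hf.abs.exists_measurable_majorant (P := P)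
  have hsub : P.real {ω | ε < |f ω|} ≤ P.real {ω | ε ≤ u ω} :=
    measureReal_mono fun ω hω => hω.le.trans (hfu ω)
  have hmarkov := mul_meas_ge_le_integral_of_nonneg (μ := P) (f := u)
    (.of_forall fun ω => (abs_nonneg _).trans (hfu ω)) hui ε
  rw [← ofReal_measureReal]
  refine ENNReal.ofReal_le_ofReal (hsub.trans ?_)
  rwa [le_div_iff₀' hε, ← hint]

lemma outerExp_abs_le_add_measureReal {ε M : ℝ} (hε : 0 ≤ ε) (hf : ∀ ω, |f ω| ≤ M) :
    outerExp P (fun ω => |f ω|) ≤ ε + M * P.real {ω | ε < |f ω|} := by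
  set s := toMeasurable P {ω | ε < |f ω|} with hs
  have hsm : MeasurableSet s := measurableSet_toMeasurable _ _
  have hle : ∀ ω, |f ω| ≤ ε + s.indicator (fun _ => M) ω := fun ω => by
    by_cases hω : ω ∈ s
    · simpa [hω] using (hf ω).trans (le_add_of_nonneg_left hε)
    · simpa [hω] using not_lt.1 fun h => hω (subset_toMeasurable _ _ h)
  have hi : Integrable (s.indicator fun _ => M) P := (integrable_const M).indicator hsm
  refine (outerExp_le_integral (IsBoundedFun.abs ⟨M, hf⟩)
    (measurable_const.add (measurable_const.indicator hsm))
    ((integrable_const ε).add hi) hle).trans_eq ?_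
  rw [integral_add' (integrable_const ε) hi, integral_indicator_const M hsm, hs,
    measureReal_def, measure_toMeasurable, ← measureReal_def]
  simp [mul_comm]

end ProbabilityMeasure

end OuterExpectation

section MeanSeminorm

variable {Ω Ω' : Type*} [MeasurableSpace Ω] [MeasurableSpace Ω'] {P : Measure Ω} {Q : Measure Ω'}

/-- The sublinear, symmetric extension of `f ↦ |∫ f dP|` to bounded functions that need not be
measurable. Both `E^*[f]` and `E_*[f]` are close to `c` exactly when `meanSeminorm P (f - c)` is
small. -/
noncomputable def meanSeminorm (P : Measure Ω) (f : Ω → ℝ) : ℝ :=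
  max (outerExp P f) (outerExp P fun ω => -f ω)

/-- The outer mean of the conditional seminorm given the first coordinate of a product space. -/
noncomputable def condMeanSeminorm (P : Measure Ω) (Q : Measure Ω') (f : Ω × Ω' → ℝ) : ℝ :=
  outerExp P fun ω => meanSeminorm Q fun ω' => f (ω, ω')

lemma outerExp_le_meanSeminorm (f : Ω → ℝ) : outerExp P f ≤ meanSeminorm P f := le_max_left _ _

lemma meanSeminorm_neg (f : Ω → ℝ) : meanSeminorm P (fun ω => -f ω) = meanSeminorm P f := by
  simp only [meanSeminorm, neg_neg, max_comm]

lemma condMeanSeminorm_comp_snd [IsProbabilityMeasure P] (f : Ω' → ℝ) :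
    condMeanSeminorm P Q (fun p => f p.2) = meanSeminorm Q f := by
  simp only [condMeanSeminorm, outerExp_const]

section FiniteMeasure

variable [IsFiniteMeasure P] {f g : Ω → ℝ}

lemma meanSeminorm_add_le (hf : IsBoundedFun f) (hg : IsBoundedFun g) :
    meanSeminorm P (fun ω => f ω + g ω) ≤ meanSeminorm P f + meanSeminorm P g := by
  refine max_le ((outerExp_add_le hf hg).trans (add_le_add (le_max_left _ _) (le_max_left _ _))) ?_
  simp only [neg_add]
  exact (outerExp_add_le hf.neg hg.neg).trans (add_le_add (le_max_right _ _) (le_max_right _ _))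

lemma meanSeminorm_const_mul_le (t : ℝ) (hf : IsBoundedFun f) :
    meanSeminorm P (fun ω => t * f ω) ≤ |t| * meanSeminorm P f := by
  have key : ∀ r : ℝ, 0 ≤ r → meanSeminorm P (fun ω => r * f ω) ≤ r * meanSeminorm P f := by
    intro r hr
    rw [meanSeminorm, meanSeminorm, mul_max_of_nonneg _ _ hr]
    simp only [← mul_neg]
    exact max_le_max (outerExp_const_mul_le hr hf) (outerExp_const_mul_le hr hf.neg)
  rcases abs_choice t with h | h
  · simpa only [h] using key |t| (abs_nonneg t)
  · rw [← meanSeminorm_neg]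
    simpa only [h, neg_mul] using key |t| (abs_nonneg t)

lemma meanSeminorm_le_outerExp_abs (hf : IsBoundedFun f) :
    meanSeminorm P f ≤ outerExp P fun ω => |f ω| :=
  max_le (outerExp_mono hf hf.abs fun _ => le_abs_self _)
    (outerExp_mono hf.neg hf.abs fun _ => neg_le_abs _)

lemma meanSeminorm_le_add_outerExp_abs_sub (hf : IsBoundedFun f) (hg : IsBoundedFun g) :
    meanSeminorm P f ≤ meanSeminorm P g + outerExp P fun ω => |f ω - g ω| := by
  have h := meanSeminorm_add_le (P := P) hg (hf.sub hg)
  simp only [add_sub_cancel] at h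
  exact h.trans (add_le_add le_rfl (meanSeminorm_le_outerExp_abs (hf.sub hg)))

lemma meanSeminorm_eq_abs_integral (hf : IsBoundedFun f) (hfm : Measurable f) :
    meanSeminorm P f = |∫ ω, f ω ∂P| := by
  rw [meanSeminorm, outerExp_eq_integral hf hfm, outerExp_eq_integral hf.neg hfm.neg, integral_neg,
    abs_eq_max_neg]

lemma meanSeminorm_zero : meanSeminorm P (fun _ => 0) = 0 := by
  simp [meanSeminorm_eq_abs_integral (P := P) (.const 0) measurable_const]

lemma meanSeminorm_nonneg (hf : IsBoundedFun f) : 0 ≤ meanSeminorm P f := by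
  have h := meanSeminorm_add_le (P := P) hf hf.neg
  simp only [add_neg_cancel, meanSeminorm_zero, meanSeminorm_neg] at h
  linarith

lemma meanSeminorm_sum_le {ι : Type*} (s : Finset ι) {f : ι → Ω → ℝ}
    (hf : ∀ i, IsBoundedFun (f i)) :
    meanSeminorm P (fun ω => ∑ i ∈ s, f i ω) ≤ ∑ i ∈ s, meanSeminorm P (f i) := by
  classical
  induction s using Finset.induction_on with
  | empty => simp [meanSeminorm_zero]
  | insert i s hi ih =>
    simp only [Finset.sum_insert hi]
    exact (meanSeminorm_add_le (hf i) (.sum hf)).trans (add_le_add le_rfl ih)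

lemma meanSeminorm_sum_mul_le {ι : Type*} [Fintype ι] {r : ι → ℝ} {M : ℝ} (hr : ∀ i, |r i| ≤ M)
    {f : ι → Ω → ℝ} (hf : ∀ i, IsBoundedFun (f i)) :
    meanSeminorm P (fun ω => ∑ i, r i * f i ω) ≤ M * ∑ i, meanSeminorm P (f i) := by
  rw [Finset.mul_sum]
  refine (meanSeminorm_sum_le _ fun i => (IsBoundedFun.const _).mul (hf i)).trans
    (Finset.sum_le_sum fun i _ => ?_)
  exact (meanSeminorm_const_mul_le _ (hf i)).trans
    (mul_le_mul_of_nonneg_right (hr i) (meanSeminorm_nonneg (hf i)))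

lemma meanSeminorm_comp_le [IsFiniteMeasure Q] {π : Ω → Ω'} (hπ : MeasurePreserving π P Q)
    {f : Ω' → ℝ} (hf : IsBoundedFun f) : meanSeminorm P (fun ω => f (π ω)) ≤ meanSeminorm Q f :=
  max_le_max (outerExp_comp_le hπ hf) (outerExp_comp_le hπ hf.neg)

end FiniteMeasure

section ProbabilityMeasure

variable [IsProbabilityMeasure P] [IsProbabilityMeasure Q] {f : Ω → ℝ}

lemma abs_meanSeminorm_le {M : ℝ} (hf : ∀ ω, |f ω| ≤ M) : |meanSeminorm P f| ≤ M :=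
  (abs_max_le_max_abs_abs).trans
    (max_le (abs_outerExp_le hf) (abs_outerExp_le fun ω => (abs_neg _).trans_le (hf ω)))

omit [MeasurableSpace Ω] in
lemma IsBoundedFun.meanSeminorm_section {f : Ω × Ω' → ℝ} (hf : IsBoundedFun f) :
    IsBoundedFun fun ω => meanSeminorm Q fun ω' => f (ω, ω') :=
  hf.imp fun _ hM _ => abs_meanSeminorm_le fun _ => hM _

lemma meanSeminorm_comp_fst (hf : IsBoundedFun f) :
    meanSeminorm (P.prod Q) (fun p => f p.1) = meanSeminorm P f := by
  rw [meanSeminorm, outerExp_comp_fst hf, outerExp_comp_fst hf.neg, meanSeminorm]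

lemma meanSeminorm_sub_const (hf : IsBoundedFun f) (c : ℝ) :
    meanSeminorm P (fun ω => f ω - c)
      = max (outerExp P f - c) (outerExp P (fun ω => -f ω) + c) := by
  rw [meanSeminorm, outerExp_sub_const c hf]
  simp only [neg_sub, sub_eq_add_neg c]
  rw [outerExp_const_add c hf.neg, add_comm c]

lemma abs_outerExp_sub_le_meanSeminorm (hf : IsBoundedFun f) (c : ℝ) :
    |outerExp P f - c| ≤ meanSeminorm P fun ω => f ω - c := by
  have h := innerExp_le_outerExp (P := P) hf
  rw [innerExp] at h
  rw [meanSeminorm_sub_const hf]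
  exact abs_le'.2 ⟨le_max_left _ _, le_max_of_le_right (by linarith)⟩

lemma outerExp_sub_innerExp_le (hf : IsBoundedFun f) (c : ℝ) :
    outerExp P f - innerExp P f ≤ 2 * meanSeminorm P fun ω => f ω - c := by
  rw [meanSeminorm_sub_const hf, innerExp]
  linarith [le_max_left (outerExp P f - c) (outerExp P (fun ω => -f ω) + c),
    le_max_right (outerExp P f - c) (outerExp P (fun ω => -f ω) + c)]

lemma meanSeminorm_sub_le {g : Ω' → ℝ} (hf : IsBoundedFun f) (hg : IsBoundedFun g) (c : ℝ) :
    meanSeminorm P (fun ω => f ω - c)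
      ≤ max |outerExp P f - outerExp Q g|
          |outerExp P (fun ω => -f ω) - outerExp Q fun ω => -g ω|
        + meanSeminorm Q fun ω => g ω - c := by
  rw [meanSeminorm_sub_const hf, meanSeminorm_sub_const hg]
  refine (max_le_max ?_ ?_).trans max_add_add_le_max_add_max
  · linarith [le_abs_self (outerExp P f - outerExp Q g)]
  · linarith [le_abs_self (outerExp P (fun ω => -f ω) - outerExp Q fun ω => -g ω)]

lemma exists_measurable_approx_of_meanSeminorm {M : ℝ} (hf : ∀ ω, |f ω| ≤ M) (c : ℝ) :
    ∃ u : Ω → ℝ, Measurable u ∧ (∀ ω, |u ω| ≤ M) ∧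
      outerExp P (fun ω => |f ω - u ω|) ≤ 2 * meanSeminorm P fun ω => f ω - c := by
  obtain ⟨u, hu, huM, hfu⟩ := exists_measurable_approx (P := P) hf
  exact ⟨u, hu, huM, hfu.trans (outerExp_sub_innerExp_le ⟨M, hf⟩ c)⟩

lemma condMeanSeminorm_nonneg {f : Ω × Ω' → ℝ} (hf : IsBoundedFun f) :
    0 ≤ condMeanSeminorm P Q f :=
  outerExp_nonneg hf.meanSeminorm_section fun _ => meanSeminorm_nonneg (hf.comp _)

lemma condMeanSeminorm_le_add_outerExp_abs_sub {f g : Ω × Ω' → ℝ} (hf : IsBoundedFun f)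
    (hg : IsBoundedFun g) :
    condMeanSeminorm P Q f
      ≤ condMeanSeminorm P Q g + outerExp (P.prod Q) fun p => |f p - g p| := by
  have hfg : IsBoundedFun fun p => |f p - g p| := (hf.sub hg).abs
  have hsec : IsBoundedFun fun ω => outerExp Q fun ω' => |f (ω, ω') - g (ω, ω')| :=
    hfg.outerExp_section
  calc condMeanSeminorm P Q f
      ≤ outerExp P (fun ω => meanSeminorm Q (fun ω' => g (ω, ω'))
          + outerExp Q fun ω' => |f (ω, ω') - g (ω, ω')|) :=
        outerExp_mono hf.meanSeminorm_section (hg.meanSeminorm_section.add hsec) fun ω =>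
          meanSeminorm_le_add_outerExp_abs_sub (hf.comp (Prod.mk ω)) (hg.comp (Prod.mk ω))
    _ ≤ condMeanSeminorm P Q g + outerExp P fun ω => outerExp Q fun ω' => |f (ω, ω') - g (ω, ω')| :=
        outerExp_add_le hg.meanSeminorm_section hsec
    _ ≤ condMeanSeminorm P Q g + outerExp (P.prod Q) fun p => |f p - g p| := by
        gcongr
        exact outerExp_outerExp_le (f := fun p => |f p - g p|) hfg

lemma condMeanSeminorm_eq_integral {f : Ω × Ω' → ℝ} (hf : IsBoundedFun f) (hfm : Measurable f) :
    condMeanSeminorm P Q f = ∫ ω, |∫ ω', f (ω, ω') ∂Q| ∂P := by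
  have hsec : ∀ ω, meanSeminorm Q (fun ω' => f (ω, ω')) = |∫ ω', f (ω, ω') ∂Q| := fun ω =>
    meanSeminorm_eq_abs_integral (hf.comp _) (hfm.comp measurable_prodMk_left)
  have hb := hf.meanSeminorm_section (Q := Q)
  rw [condMeanSeminorm]
  simp only [hsec] at hb ⊢
  exact outerExp_eq_integral hb
    (continuous_abs.measurable.comp hfm.stronglyMeasurable.integral_prod_right'.measurable)

/-- The defect term is needed since outer expectation under `P.prod Q` can exceed the iterated
outer expectation. -/
lemma meanSeminorm_prod_le {f : Ω × Ω' → ℝ} (hf : IsBoundedFun f) :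
    meanSeminorm (P.prod Q) f
      ≤ condMeanSeminorm P Q f + 2 * (outerExp (P.prod Q) f - innerExp (P.prod Q) f) := by
  obtain ⟨M, hM⟩ := hf
  obtain ⟨u, hu, huM, hfu⟩ := exists_measurable_approx (P := P.prod Q) hM
  have hub : IsBoundedFun u := ⟨M, huM⟩
  have hmeas : meanSeminorm (P.prod Q) u ≤ condMeanSeminorm P Q u := by
    rw [meanSeminorm_eq_abs_integral hub hu, condMeanSeminorm_eq_integral hub hu,
      integral_prod _ (hub.integrable hu)]
    exact abs_integral_le_integral_abs
  have hf' := meanSeminorm_le_add_outerExp_abs_sub (P := P.prod Q) ⟨M, hM⟩ hub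
  have hu' := condMeanSeminorm_le_add_outerExp_abs_sub (P := P) (Q := Q) hub ⟨M, hM⟩
  simp only [abs_sub_comm (u _)] at hu'
  linarith

end ProbabilityMeasure

end MeanSeminorm

section ConditionalProducts

lemma abs_mul_sub_mul_le {a b a' b' : ℝ} (ha : |a| ≤ 1) (hb' : |b'| ≤ 1) :
    |a * b - a' * b'| ≤ |a - a'| + |b - b'| := by
  rw [show a * b - a' * b' = (a - a') * b' + a * (b - b') by ring]
  refine (abs_add_le _ _).trans ?_
  rw [abs_mul, abs_mul]
  exact add_le_add (mul_le_of_le_one_right (abs_nonneg _) hb')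
    (mul_le_of_le_one_left (abs_nonneg _) ha)

lemma abs_mul_le_one {a b : ℝ} (ha : |a| ≤ 1) (hb : |b| ≤ 1) : |a * b| ≤ 1 := by
  rw [abs_mul]
  exact mul_le_one₀ ha (abs_nonneg _) hb

lemma abs_mul_mul_sub_mul_mul_le {a b c a' b' c' : ℝ} (ha : |a| ≤ 1) (hb : |b| ≤ 1)
    (hb' : |b'| ≤ 1) (hc' : |c'| ≤ 1) :
    |a * (b * c) - a' * (b' * c')| ≤ |a - a'| + |b - b'| + |c - c'| := by
  rw [add_assoc]
  exact (abs_mul_sub_mul_le ha (abs_mul_le_one hb' hc')).trans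
    (add_le_add le_rfl (abs_mul_sub_mul_le hb hc'))

variable {Ω Ω' : Type*} [MeasurableSpace Ω] [MeasurableSpace Ω'] {P : Measure Ω} {Q : Measure Ω'}
  [IsProbabilityMeasure P] [IsProbabilityMeasure Q] {a b c : ℝ}

lemma abs_integral_le_of_forall_abs_le {v : Ω → ℝ} {M : ℝ} (hv : ∀ ω, |v ω| ≤ M) :
    |∫ ω, v ω ∂P| ≤ M := by
  simpa using norm_integral_le_of_norm_le_const (μ := P) (f := v) (C := M) (.of_forall hv)

lemma meanSeminorm_prod_eq {f : Ω × Ω' → ℝ} (hf : IsBoundedFun f) (hfm : Measurable f) :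
    meanSeminorm (P.prod Q) f = meanSeminorm P fun ω => ∫ ω', f (ω, ω') ∂Q := by
  obtain ⟨M, hM⟩ := hf
  have hb : IsBoundedFun fun ω => ∫ ω', f (ω, ω') ∂Q := ⟨M, fun ω =>
    abs_integral_le_of_forall_abs_le fun ω' => hM (ω, ω')⟩
  rw [meanSeminorm_eq_abs_integral ⟨M, hM⟩ hfm, meanSeminorm_eq_abs_integral hb
    hfm.stronglyMeasurable.integral_prod_right'.measurable,
    integral_prod _ (IsBoundedFun.integrable ⟨M, hM⟩ hfm)]

lemma meanSeminorm_mul_mul_sub_le {u v w : Ω → ℝ} (hu : ∀ ω, |u ω| ≤ 1) (hv : ∀ ω, |v ω| ≤ 1)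
    (hw : ∀ ω, |w ω| ≤ 1) (hb : |b| ≤ 1) (hc : |c| ≤ 1) :
    meanSeminorm P (fun ω => u ω * (v ω * w ω) - a * (b * c))
      ≤ meanSeminorm P (fun ω => u ω - a) + outerExp P (fun ω => |v ω - b|)
        + outerExp P fun ω => |w ω - c| := by
  have hub : IsBoundedFun u := ⟨1, hu⟩
  have hvb : IsBoundedFun v := ⟨1, hv⟩
  have hwb : IsBoundedFun w := ⟨1, hw⟩
  have hua := hub.sub (.const a)
  have hvw := hub.mul ((hvb.mul hwb).sub (.const (b * c)))
  have hvb' := (hvb.sub (.const b)).abs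
  have hwc' := (hwb.sub (.const c)).abs
  have hsplit : ∀ ω, u ω * (v ω * w ω) - a * (b * c)
      = b * c * (u ω - a) + u ω * (v ω * w ω - b * c) := fun ω => by ring
  simp only [hsplit]
  refine (meanSeminorm_add_le ((IsBoundedFun.const (b * c)).mul hua) hvw).trans ?_
  rw [add_assoc]
  refine add_le_add ((meanSeminorm_const_mul_le _ hua).trans
    (mul_le_of_le_one_left (meanSeminorm_nonneg hua) (abs_mul_le_one hb hc))) ?_
  refine (meanSeminorm_le_outerExp_abs hvw).trans
    ((outerExp_mono hvw.abs (hvb'.add hwc') fun ω => ?_).trans (outerExp_add_le hvb' hwc'))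
  rw [abs_mul]
  exact (mul_le_of_le_one_left (abs_nonneg _) (hu ω)).trans (abs_mul_sub_mul_le (hv ω) hc)

lemma integral_prod_mul_sub_const {v w : Ω' → ℝ} (hv : Integrable v Q) (hw : Integrable w Q)
    (s t : ℝ) : ∫ q, (s * (v q.1 * w q.2) - t) ∂Q.prod Q
      = s * ((∫ ω', v ω' ∂Q) * ∫ ω', w ω' ∂Q) - t := by
  rw [integral_sub ((hv.mul_prod hw).const_mul s) (integrable_const t), integral_const_mul,
    integral_prod_mul]
  simp

omit [IsProbabilityMeasure P] in
lemma condMeanSeminorm_sub_eq {v : Ω × Ω' → ℝ} (hv : Measurable v) (hvb : IsBoundedFun v) (b : ℝ) :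
    condMeanSeminorm P Q (fun p => v p - b)
      = outerExp P fun ω => |∫ ω', v (ω, ω') ∂Q - b| := by
  have hsec : ∀ ω, Measurable fun ω' => v (ω, ω') := fun ω => hv.comp measurable_prodMk_left
  have hsecb : ∀ ω, IsBoundedFun fun ω' => v (ω, ω') := fun ω => hvb.comp _
  simp only [condMeanSeminorm,
    meanSeminorm_eq_abs_integral ((hsecb _).sub (.const b)) ((hsec _).sub_const b),
    integral_sub ((hsecb _).integrable (hsec _)) (integrable_const b), integral_const,
    probReal_univ, one_smul]

lemma meanSeminorm_mul_sections_sub_le_of_measurable {u : Ω → ℝ} {v w : Ω × Ω' → ℝ}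
    (hu : Measurable u) (hv : Measurable v) (hw : Measurable w) (hu1 : ∀ ω, |u ω| ≤ 1)
    (hv1 : ∀ p, |v p| ≤ 1) (hw1 : ∀ p, |w p| ≤ 1) (hb : |b| ≤ 1) (hc : |c| ≤ 1) :
    meanSeminorm (P.prod (Q.prod Q))
        (fun p => u p.1 * (v (p.1, p.2.1) * w (p.1, p.2.2)) - a * (b * c))
      ≤ meanSeminorm P (fun ω => u ω - a) + condMeanSeminorm P Q (fun p => v p - b)
        + condMeanSeminorm P Q fun p => w p - c := by
  have hint : ∀ {z : Ω × Ω' → ℝ}, Measurable z → (∀ p, |z p| ≤ 1) → ∀ ω,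
      Integrable (fun ω' => z (ω, ω')) Q := fun hz hz1 ω =>
    IsBoundedFun.integrable ⟨1, fun _ => hz1 _⟩ (hz.comp measurable_prodMk_left)
  have hmeas : Measurable fun p : Ω × Ω' × Ω' =>
      u p.1 * (v (p.1, p.2.1) * w (p.1, p.2.2)) - a * (b * c) := by fun_prop
  have hbdd : IsBoundedFun fun p : Ω × Ω' × Ω' =>
      u p.1 * (v (p.1, p.2.1) * w (p.1, p.2.2)) - a * (b * c) :=
    .sub ⟨1, fun p => abs_mul_le_one (hu1 _) (abs_mul_le_one (hv1 _) (hw1 _))⟩ (.const _)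
  rw [meanSeminorm_prod_eq hbdd hmeas, condMeanSeminorm_sub_eq hv ⟨1, hv1⟩,
    condMeanSeminorm_sub_eq hw ⟨1, hw1⟩]
  simp only [integral_prod_mul_sub_const (hint hv hv1 _) (hint hw hw1 _)]
  exact meanSeminorm_mul_mul_sub_le hu1 (fun ω => abs_integral_le_of_forall_abs_le fun _ => hv1 _)
    (fun ω => abs_integral_le_of_forall_abs_le fun _ => hw1 _) hb hc

lemma measurePreserving_fst_snd_fst : MeasurePreserving (fun p : Ω × Ω' × Ω' => (p.1, p.2.1))
    (P.prod (Q.prod Q)) (P.prod Q) :=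
  (MeasurePreserving.id P).prod measurePreserving_fst

lemma measurePreserving_fst_snd_snd : MeasurePreserving (fun p : Ω × Ω' × Ω' => (p.1, p.2.2))
    (P.prod (Q.prod Q)) (P.prod Q) :=
  (MeasurePreserving.id P).prod measurePreserving_snd

lemma meanSeminorm_comp_fst_snd_fst {f : Ω × Ω' → ℝ} (hf : IsBoundedFun f) :
    meanSeminorm (P.prod (Q.prod Q)) (fun p => f (p.1, p.2.1)) = meanSeminorm (P.prod Q) f := by
  refine (meanSeminorm_comp_le measurePreserving_fst_snd_fst hf).antisymm ?_
  rw [← meanSeminorm_comp_fst (Q := Q) hf]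
  exact meanSeminorm_comp_le (measurePreserving_prodAssoc P Q Q)
    (hf.comp fun p : Ω × Ω' × Ω' => (p.1, p.2.1))

lemma outerExp_abs_mul_sections_sub_le {f u : Ω → ℝ} {g h v w : Ω × Ω' → ℝ}
    (hf : ∀ ω, |f ω| ≤ 1) (hg : ∀ p, |g p| ≤ 1) (hh : ∀ p, |h p| ≤ 1) (hu : ∀ ω, |u ω| ≤ 1)
    (hv : ∀ p, |v p| ≤ 1) (hw : ∀ p, |w p| ≤ 1) :
    outerExp (P.prod (Q.prod Q)) (fun p => |f p.1 * (g (p.1, p.2.1) * h (p.1, p.2.2))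
        - u p.1 * (v (p.1, p.2.1) * w (p.1, p.2.2))|)
      ≤ outerExp P (fun ω => |f ω - u ω|) + outerExp (P.prod Q) (fun p => |g p - v p|)
        + outerExp (P.prod Q) fun p => |h p - w p| := by
  have hfu : IsBoundedFun fun ω => |f ω - u ω| := (IsBoundedFun.sub ⟨1, hf⟩ ⟨1, hu⟩).abs
  have hgv : IsBoundedFun fun p => |g p - v p| := (IsBoundedFun.sub ⟨1, hg⟩ ⟨1, hv⟩).abs
  have hhw : IsBoundedFun fun p => |h p - w p| := (IsBoundedFun.sub ⟨1, hh⟩ ⟨1, hw⟩).abs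
  have hfu' := hfu.comp (Prod.fst : Ω × Ω' × Ω' → Ω)
  have hgv' := hgv.comp fun p : Ω × Ω' × Ω' => (p.1, p.2.1)
  have hhw' := hhw.comp fun p : Ω × Ω' × Ω' => (p.1, p.2.2)
  have hprod : ∀ {x : Ω → ℝ} {y z : Ω × Ω' → ℝ}, (∀ ω, |x ω| ≤ 1) → (∀ p, |y p| ≤ 1) →
      (∀ p, |z p| ≤ 1) →
      IsBoundedFun fun p : Ω × Ω' × Ω' => x p.1 * (y (p.1, p.2.1) * z (p.1, p.2.2)) :=
    fun hx hy hz => ⟨1, fun _ => abs_mul_le_one (hx _) (abs_mul_le_one (hy _) (hz _))⟩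
  refine (outerExp_mono ((hprod hf hg hh).sub (hprod hu hv hw)).abs ((hfu'.add hgv').add hhw')
    fun p => abs_mul_mul_sub_mul_mul_le (hf _) (hg _) (hv _) (hw _)).trans ?_
  refine (outerExp_add_le (hfu'.add hgv') hhw').trans (add_le_add
    ((outerExp_add_le hfu' hgv').trans (add_le_add ?_ ?_)) ?_)
  · exact outerExp_comp_le measurePreserving_fst hfu
  · exact outerExp_comp_le measurePreserving_fst_snd_fst hgv
  · exact outerExp_comp_le measurePreserving_fst_snd_snd hhw

lemma meanSeminorm_mul_sections_sub_le {f : Ω → ℝ} {g h : Ω × Ω' → ℝ} (hf : ∀ ω, |f ω| ≤ 1)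
    (hg : ∀ p, |g p| ≤ 1) (hh : ∀ p, |h p| ≤ 1) (hb : |b| ≤ 1) (hc : |c| ≤ 1) :
    meanSeminorm (P.prod (Q.prod Q))
        (fun p => f p.1 * (g (p.1, p.2.1) * h (p.1, p.2.2)) - a * (b * c))
      ≤ 5 * meanSeminorm P (fun ω => f ω - a)
        + (condMeanSeminorm P Q (fun p => g p - b)
          + 4 * meanSeminorm (P.prod Q) fun p => g p - b)
        + (condMeanSeminorm P Q (fun p => h p - c)
          + 4 * meanSeminorm (P.prod Q) fun p => h p - c) := by
  obtain ⟨u, hu, hu1, hfu⟩ := exists_measurable_approx_of_meanSeminorm (P := P) hf a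
  obtain ⟨v, hv, hv1, hgv⟩ := exists_measurable_approx_of_meanSeminorm (P := P.prod Q) hg b
  obtain ⟨w, hw, hw1, hhw⟩ := exists_measurable_approx_of_meanSeminorm (P := P.prod Q) hh c
  have hu' := meanSeminorm_le_add_outerExp_abs_sub (P := P)
    (IsBoundedFun.sub ⟨1, hu1⟩ (.const a)) (IsBoundedFun.sub ⟨1, hf⟩ (.const a))
  have hv' := condMeanSeminorm_le_add_outerExp_abs_sub (P := P) (Q := Q)
    (IsBoundedFun.sub ⟨1, hv1⟩ (.const b)) (IsBoundedFun.sub ⟨1, hg⟩ (.const b))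
  have hw' := condMeanSeminorm_le_add_outerExp_abs_sub (P := P) (Q := Q)
    (IsBoundedFun.sub ⟨1, hw1⟩ (.const c)) (IsBoundedFun.sub ⟨1, hh⟩ (.const c))
  have hprod := meanSeminorm_le_add_outerExp_abs_sub (P := P.prod (Q.prod Q))
    (f := fun p => f p.1 * (g (p.1, p.2.1) * h (p.1, p.2.2)) - a * (b * c))
    (g := fun p => u p.1 * (v (p.1, p.2.1) * w (p.1, p.2.2)) - a * (b * c))
    (.sub ⟨1, fun p => abs_mul_le_one (hf _) (abs_mul_le_one (hg _) (hh _))⟩ (.const _))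
    (.sub ⟨1, fun p => abs_mul_le_one (hu1 _) (abs_mul_le_one (hv1 _) (hw1 _))⟩ (.const _))
  have hmeas := meanSeminorm_mul_sections_sub_le_of_measurable (P := P) (Q := Q) (a := a)
    hu hv hw hu1 hv1 hw1 hb hc
  have herr := outerExp_abs_mul_sections_sub_le (P := P) (Q := Q) hf hg hh hu1 hv1 hw1
  simp only [sub_sub_sub_cancel_right] at hu' hv' hw' hprod
  simp only [abs_sub_comm (u _)] at hu'
  simp only [abs_sub_comm (v _)] at hv'
  simp only [abs_sub_comm (w _)] at hw'
  linarith

lemma sq_integral_abs_le {W : Ω → ℝ} (hW : Measurable W) (hWb : IsBoundedFun W) :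
    (∫ ω, |W ω| ∂P) ^ 2 ≤ ∫ ω, W ω ^ 2 ∂P := by
  obtain ⟨M, hM⟩ := hWb.abs
  have h := ProbabilityTheory.variance_nonneg (fun ω => |W ω|) P
  rw [ProbabilityTheory.variance_eq_sub
    (.of_bound (by fun_prop) M (.of_forall hM))] at h
  simpa using h

lemma outerExp_abs_sub_le_sqrt {V : Ω → ℝ} (hV : Measurable V) (hVb : IsBoundedFun V)
    (hb : |b| ≤ 1) :
    outerExp P (fun ω => |V ω - b|)
      ≤ √(meanSeminorm P (fun ω => V ω * V ω - b * b) + 2 * meanSeminorm P fun ω => V ω - b) := by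
  have hVbb : IsBoundedFun fun ω => V ω - b := hVb.sub (.const b)
  have hVVb : IsBoundedFun fun ω => V ω * V ω - b * b := (hVb.mul hVb).sub (.const _)
  have hVbm : Measurable fun ω => V ω - b := hV.sub_const b
  have hVVm : Measurable fun ω => V ω * V ω - b * b := (hV.mul hV).sub_const _
  have hsq : ∫ ω, (V ω - b) ^ 2 ∂P
      = ∫ ω, (V ω * V ω - b * b) ∂P - 2 * b * ∫ ω, (V ω - b) ∂P := by
    rw [← integral_const_mul,
      ← integral_sub (hVVb.integrable hVVm) ((hVbb.integrable hVbm).const_mul _)]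
    exact integral_congr_ae (.of_forall fun ω => by ring)
  have hcross : |2 * b * ∫ ω, (V ω - b) ∂P| ≤ 2 * |∫ ω, (V ω - b) ∂P| := by
    rw [mul_assoc, abs_mul, abs_two, abs_mul]
    exact mul_le_mul_of_nonneg_left (mul_le_of_le_one_left (abs_nonneg _) hb) zero_le_two
  rw [outerExp_eq_integral hVbb.abs (by fun_prop), meanSeminorm_eq_abs_integral hVVb hVVm,
    meanSeminorm_eq_abs_integral hVbb hVbm]
  refine Real.le_sqrt_of_sq_le ((sq_integral_abs_le hVbm hVbb).trans ?_)
  linarith [le_abs_self (∫ ω, (V ω * V ω - b * b) ∂P), neg_abs_le (2 * b * ∫ ω, (V ω - b) ∂P)]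

/-- Two conditionally independent copies turn the second moment of the conditional mean into a
mixed moment: `E[E[v | ω]²] = E[v(ω, ω₁) v(ω, ω₂)]`. -/
lemma condMeanSeminorm_sub_le_sqrt_of_measurable {v : Ω × Ω' → ℝ} (hv : Measurable v)
    (hv1 : ∀ p, |v p| ≤ 1) (hb : |b| ≤ 1) :
    condMeanSeminorm P Q (fun p => v p - b)
      ≤ √(meanSeminorm (P.prod (Q.prod Q)) (fun p => v (p.1, p.2.1) * v (p.1, p.2.2) - b * b)
        + 2 * meanSeminorm (P.prod Q) fun p => v p - b) := by
  have hvi : ∀ ω, Integrable (fun ω' => v (ω, ω')) Q := fun ω =>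
    IsBoundedFun.integrable ⟨1, fun _ => hv1 _⟩ (hv.comp measurable_prodMk_left)
  have hmixed : ∀ ω, ∫ q : Ω' × Ω', (v (ω, q.1) * v (ω, q.2) - b * b) ∂Q.prod Q
      = (∫ ω', v (ω, ω') ∂Q) * (∫ ω', v (ω, ω') ∂Q) - b * b := fun ω => by
    simpa only [one_mul] using integral_prod_mul_sub_const (hvi ω) (hvi ω) 1 (b * b)
  rw [condMeanSeminorm_sub_eq hv ⟨1, hv1⟩, meanSeminorm_prod_eq
    (.sub ⟨1, fun p => abs_mul_le_one (hv1 _) (hv1 _)⟩ (.const _)) (by fun_prop),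
    meanSeminorm_prod_eq (.sub ⟨1, hv1⟩ (.const b)) (hv.sub_const b)]
  simp only [hmixed, integral_sub (hvi _) (integrable_const b), integral_const, probReal_univ,
    one_smul]
  exact outerExp_abs_sub_le_sqrt hv.stronglyMeasurable.integral_prod_right'.measurable
    ⟨1, fun ω => abs_integral_le_of_forall_abs_le fun _ => hv1 _⟩ hb

lemma condMeanSeminorm_sub_le_sqrt {g : Ω × Ω' → ℝ} (hg : ∀ p, |g p| ≤ 1) (hb : |b| ≤ 1) :
    condMeanSeminorm P Q (fun p => g p - b)
      ≤ 2 * meanSeminorm (P.prod Q) (fun p => g p - b)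
        + √(meanSeminorm (P.prod (Q.prod Q)) (fun p => g (p.1, p.2.1) * g (p.1, p.2.2) - b * b)
          + 10 * meanSeminorm (P.prod Q) fun p => g p - b) := by
  obtain ⟨v, hv, hv1, hgv⟩ := exists_measurable_approx_of_meanSeminorm (P := P.prod Q) hg b
  have hgb : IsBoundedFun fun p => g p - b := .sub ⟨1, hg⟩ (.const b)
  have hvb : IsBoundedFun fun p => v p - b := .sub ⟨1, hv1⟩ (.const b)
  have hcond := condMeanSeminorm_le_add_outerExp_abs_sub (P := P) (Q := Q) hgb hvb
  have hmean := meanSeminorm_le_add_outerExp_abs_sub (P := P.prod Q) hvb hgb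
  have hmixed := meanSeminorm_le_add_outerExp_abs_sub (P := P.prod (Q.prod Q))
    (f := fun p => v (p.1, p.2.1) * v (p.1, p.2.2) - b * b)
    (g := fun p => g (p.1, p.2.1) * g (p.1, p.2.2) - b * b)
    (.sub ⟨1, fun p => abs_mul_le_one (hv1 _) (hv1 _)⟩ (.const _))
    (.sub ⟨1, fun p => abs_mul_le_one (hg _) (hg _)⟩ (.const _))
  have herr := outerExp_abs_mul_sections_sub_le (P := P) (Q := Q) (f := fun _ => 1)
    (u := fun _ => 1) (by simp) hv1 hv1 (by simp) hg hg
  simp only [one_mul, sub_self, abs_zero, outerExp_const, zero_add] at herr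
  simp only [sub_sub_sub_cancel_right] at hcond hmean hmixed
  simp only [abs_sub_comm (v _)] at hmean herr
  refine hcond.trans ((add_le_add
    (condMeanSeminorm_sub_le_sqrt_of_measurable hv hv1 hb) hgv).trans ?_)
  rw [add_comm]
  refine add_le_add le_rfl (Real.sqrt_le_sqrt ?_)
  linarith

end ConditionalProducts

/-- A finite family of nonnegative continuous bumps on `D` with sum at most `1`, the `i`-th bump
vanishing outside the `δ`-ball around `center i`. A partition of unity on the set where the sum is
`1`; how much mass a law gives to the rest is controlled separately. -/
structure BumpFamily (ι D : Type*) [Fintype ι] [PseudoMetricSpace D] (δ : ℝ) where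
  center : ι → D
  weight : ι → D →ᵇ ℝ
  weight_nonneg : ∀ i x, 0 ≤ weight i x
  sum_weight_le_one : ∀ x, ∑ i, weight i x ≤ 1
  dist_center_lt : ∀ i x, weight i x ≠ 0 → dist (center i) x < δ

namespace BumpFamily

variable {ι κ D E : Type*} [Fintype ι] [Fintype κ] [PseudoMetricSpace D] [PseudoMetricSpace E]
  {δ : ℝ}

lemma weight_le_one (φ : BumpFamily ι D δ) (i : ι) (x : D) : φ.weight i x ≤ 1 :=
  (Finset.single_le_sum (f := fun i => φ.weight i x) (fun j _ => φ.weight_nonneg j x)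
    (Finset.mem_univ i)).trans (φ.sum_weight_le_one x)

lemma abs_weight_le_one (φ : BumpFamily ι D δ) (i : ι) (x : D) : |φ.weight i x| ≤ 1 :=
  (abs_of_nonneg (φ.weight_nonneg i x)).trans_le (φ.weight_le_one i x)

/-- The products of the bumps of two families, a bump family for the maximum distance. -/
def prod (φ : BumpFamily ι D δ) (χ : BumpFamily κ E δ) : BumpFamily (ι × κ) (D × E) δ where
  center q := (φ.center q.1, χ.center q.2)
  weight q := (φ.weight q.1).compContinuous ⟨Prod.fst, continuous_fst⟩ *
    (χ.weight q.2).compContinuous ⟨Prod.snd, continuous_snd⟩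
  weight_nonneg q x := mul_nonneg (φ.weight_nonneg q.1 x.1) (χ.weight_nonneg q.2 x.2)
  sum_weight_le_one x := by
    simp only [BoundedContinuousFunction.mul_apply, BoundedContinuousFunction.compContinuous_apply,
      ContinuousMap.coe_mk, Fintype.sum_prod_type, ← Finset.sum_mul_sum]
    exact mul_le_one₀ (φ.sum_weight_le_one x.1)
      (Finset.sum_nonneg fun j _ => χ.weight_nonneg j x.2) (χ.sum_weight_le_one x.2)
  dist_center_lt q x hq := max_lt (φ.dist_center_lt q.1 x.1 (left_ne_zero_of_mul hq))
    (χ.dist_center_lt q.2 x.2 (right_ne_zero_of_mul hq))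

/-- Adds a bump at `x` to the family, cut down so that the sum of all bumps becomes the maximum of
the old sum and the profile `b`. -/
def insert (φ : BumpFamily ι D δ) (x : D) (b : D →ᵇ ℝ) (hb : ∀ y, b y ≤ 1)
    (hbx : ∀ y, δ ≤ dist x y → b y ≤ 0) : BumpFamily (Option ι) D δ where
  center i := i.elim x φ.center
  weight i := i.elim (b ⊔ ∑ j, φ.weight j - ∑ j, φ.weight j) φ.weight
  weight_nonneg i y := by
    cases i with
    | none => simp
    | some i => exact φ.weight_nonneg i y
  sum_weight_le_one y := by
    simpa [Fintype.sum_option] using ⟨hb y, φ.sum_weight_le_one y⟩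
  dist_center_lt i y hi := by
    cases i with
    | none =>
      by_contra! hxy
      refine hi ?_
      simpa [sub_eq_zero] using
        (hbx y hxy).trans (Finset.sum_nonneg fun j _ => φ.weight_nonneg j y)
    | some i => exact φ.dist_center_lt i y hi

lemma weight_prod_apply (φ : BumpFamily ι D δ) (χ : BumpFamily κ E δ) (q : ι × κ) (x : D × E) :
    (φ.prod χ).weight q x = φ.weight q.1 x.1 * χ.weight q.2 x.2 := rfl

lemma sum_weight_insert (φ : BumpFamily ι D δ) {x : D} {b : D →ᵇ ℝ} {hb : ∀ y, b y ≤ 1}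
    {hbx : ∀ y, δ ≤ dist x y → b y ≤ 0} (y : D) :
    ∑ i, (φ.insert x b hb hbx).weight i y = max (b y) (∑ i, φ.weight i y) := by
  simp [insert, Fintype.sum_option]

lemma exists_lipschitzWith_bump (x : D) (hδ : 0 < δ) :
    ∃ b : D →ᵇ ℝ, (∃ C, LipschitzWith C b) ∧ (∀ y, b y ≤ 1) ∧ (∀ y, δ ≤ dist x y → b y ≤ 0) ∧
      ∀ y, dist x y < δ / 2 → b y = 1 := by
  let θ := thickenedIndicator (half_pos hδ) (Metric.ball x (δ / 2))
  have hcoe : LipschitzWith 1 ((↑) : NNReal → ℝ) := LipschitzWith.subtype_val _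
  refine ⟨θ.comp _ hcoe, ⟨_, hcoe.comp (lipschitzWith_thickenedIndicator _ _)⟩, fun y => ?_,
    fun y hy => ?_, fun y hy => ?_⟩
  · exact NNReal.coe_le_one.2 (thickenedIndicator_le_one _ _ y)
  · have hy' : y ∉ Metric.thickening (δ / 2) (Metric.ball x (δ / 2)) := fun h => by
      have := Metric.mem_ball'.1 (Metric.thickening_ball x _ _ h)
      linarith
    simp [θ, thickenedIndicator_zero _ _ hy']
  · have hy' : y ∈ Metric.ball x (δ / 2) := by rwa [Metric.mem_ball']
    simp [θ, thickenedIndicator_one _ _ hy']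

lemma exists_lipschitzWith_of_finite {t : Set D} (ht : t.Finite) (hδ : 0 < δ) :
    ∃ (ι : Type) (_ : Fintype ι) (φ : BumpFamily ι D δ), (∀ i, φ.center i ∈ t) ∧
      (∀ i, ∃ C, LipschitzWith C (φ.weight i)) ∧ (∃ C, LipschitzWith C fun y => ∑ i, φ.weight i y) ∧
      ∀ x ∈ t, ∀ y, dist x y < δ / 2 → ∑ i, φ.weight i y = 1 := by
  induction t, ht using Set.Finite.induction_on with
  | empty =>
    exact ⟨Empty, inferInstance, ⟨Empty.elim, Empty.elim, fun i => i.elim, by simp,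
      fun i => i.elim⟩, fun i => i.elim, fun i => i.elim, ⟨0, by simp⟩, by simp⟩
  | @insert x t _ _ ih =>
    obtain ⟨ι, _, φ, hcenter, hlip, ⟨C, hC⟩, hsum⟩ := ih
    obtain ⟨b, ⟨B, hB⟩, hb1, hb0, hbx⟩ := exists_lipschitzWith_bump x hδ
    refine ⟨Option ι, inferInstance, φ.insert x b hb1 hb0, fun i => ?_, fun i => ?_,
      ⟨_, by simpa only [sum_weight_insert] using hB.max hC⟩, fun z hz y hzy => ?_⟩
    · cases i with
      | none => exact Set.mem_insert _ _
      | some i => exact Set.mem_insert_of_mem _ (hcenter i)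
    · cases i with
      | none =>
        have hnone : ⇑((φ.insert x b hb1 hb0).weight none)
            = fun y => max (b y) (∑ i, φ.weight i y) - ∑ i, φ.weight i y := by
          ext y
          simp [BumpFamily.insert]
        exact ⟨_, hnone ▸ (hB.max hC).sub hC⟩
      | some i => exact hlip i
    · rw [sum_weight_insert]
      rcases hz with rfl | hz
      · rw [hbx y hzy, max_eq_left (φ.sum_weight_le_one y)]
      · rw [hsum z hz y hzy, max_eq_right (hb1 y)]

lemma exists_lipschitzWith_of_isCompact {K : Set D} (hK : IsCompact K) (hδ : 0 < δ) :
    ∃ (ι : Type) (_ : Fintype ι) (φ : BumpFamily ι D δ), (∀ i, φ.center i ∈ K) ∧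
      (∀ i, ∃ C, LipschitzWith C (φ.weight i)) ∧ ∀ y ∈ K, ∑ i, φ.weight i y = 1 := by
  obtain ⟨t, htK, ht, hcover⟩ := hK.finite_cover_balls (half_pos hδ)
  obtain ⟨ι, _, φ, hcenter, hlip, -, hsum⟩ := exists_lipschitzWith_of_finite ht hδ
  refine ⟨ι, _, φ, fun i => htK (hcenter i), hlip, fun y hy => ?_⟩
  obtain ⟨x, hx, hxy⟩ := Set.mem_iUnion₂.1 (hcover hy)
  exact hsum x hx y (Metric.mem_ball'.1 hxy)

lemma abs_sub_sum_mul_weight_le (φ : BumpFamily ι D δ) {f : D → ℝ} {M ε : ℝ}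
    (hM : ∀ x, |f x| ≤ M) (hf : ∀ i x, dist (φ.center i) x < δ → |f (φ.center i) - f x| ≤ ε)
    (hε : 0 ≤ ε) (x : D) :
    |f x - ∑ i, f (φ.center i) * φ.weight i x| ≤ ε + M * (1 - ∑ i, φ.weight i x) := by
  have hsplit : f x - ∑ i, f (φ.center i) * φ.weight i x
      = f x * (1 - ∑ i, φ.weight i x) - ∑ i, (f (φ.center i) - f x) * φ.weight i x := by
    simp only [sub_mul, Finset.sum_sub_distrib, ← Finset.mul_sum]
    ring
  have hsum : |∑ i, (f (φ.center i) - f x) * φ.weight i x| ≤ ε := by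
    refine (Finset.abs_sum_le_sum_abs _ _).trans ((Finset.sum_le_sum
      (g := fun i => ε * φ.weight i x) fun i _ => ?_).trans ?_)
    · rw [abs_mul, abs_of_nonneg (φ.weight_nonneg i x)]
      rcases eq_or_ne (φ.weight i x) 0 with h | h
      · simp [h]
      · exact mul_le_mul_of_nonneg_right (hf i x (φ.dist_center_lt i x h)) (φ.weight_nonneg i x)
    · rw [← Finset.mul_sum]
      exact mul_le_of_le_one_right hε (φ.sum_weight_le_one x)
  have hrest := mul_le_mul_of_nonneg_right (hM x) (sub_nonneg.2 (φ.sum_weight_le_one x))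
  rw [hsplit, add_comm ε]
  refine (abs_sub _ _).trans (add_le_add ?_ hsum)
  rwa [abs_mul, abs_of_nonneg (sub_nonneg.2 (φ.sum_weight_le_one x))]

section Means

variable {Ω Ω' : Type*} [MeasurableSpace Ω] {P : Measure Ω} [IsProbabilityMeasure P]
  [MeasurableSpace Ω'] {Q : Measure Ω'} [IsProbabilityMeasure Q]

lemma meanSeminorm_sub_sum_le (φ : BumpFamily ι D δ) {f : D → ℝ} {M ε : ℝ}
    (hM : ∀ x, |f x| ≤ M) (hf : ∀ i x, dist (φ.center i) x < δ → |f (φ.center i) - f x| ≤ ε)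
    (hε : 0 ≤ ε) (Z : Ω → D) (c : ι → ℝ) :
    meanSeminorm P (fun ω => f (Z ω) - ∑ i, f (φ.center i) * c i)
      ≤ ε + M * (1 - ∑ i, c i) + 2 * M * ∑ i, meanSeminorm P fun ω => φ.weight i (Z ω) - c i := by
  have hM0 : 0 ≤ M := by
    obtain ⟨ω⟩ := nonempty_of_isProbabilityMeasure P
    exact (abs_nonneg _).trans (hM (Z ω))
  have hfb : IsBoundedFun fun ω => f (Z ω) := ⟨M, fun ω => hM _⟩
  have hwb : ∀ i, IsBoundedFun fun ω => φ.weight i (Z ω) - c i := fun i =>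
    (IsBoundedFun.bcf _ Z).sub (.const _)
  have hsb : IsBoundedFun fun ω => ∑ i, f (φ.center i) * (φ.weight i (Z ω) - c i) :=
    .sum fun i => (IsBoundedFun.const _).mul (hwb i)
  have hdefect : IsBoundedFun fun ω => ∑ i, -M * (φ.weight i (Z ω) - c i) :=
    .sum fun i => (IsBoundedFun.const _).mul (hwb i)
  have hpoint : ∀ ω, |f (Z ω) - ∑ i, f (φ.center i) * c i
      - ∑ i, f (φ.center i) * (φ.weight i (Z ω) - c i)|
      ≤ (ε + M * (1 - ∑ i, c i)) + ∑ i, -M * (φ.weight i (Z ω) - c i) := fun ω => by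
    have h := φ.abs_sub_sum_mul_weight_le hM hf hε (Z ω)
    simp only [mul_sub, Finset.sum_sub_distrib, ← Finset.mul_sum, sub_sub,
      add_sub_cancel] at h ⊢
    linarith
  have herr := outerExp_mono (P := P) ((hfb.sub (.const _)).sub hsb).abs
    ((IsBoundedFun.const _).add hdefect) hpoint
  rw [outerExp_const_add _ hdefect] at herr
  have hlow := (outerExp_le_meanSeminorm _).trans
    (meanSeminorm_sum_mul_le (P := P) (r := fun _ => -M)
      (fun _ => by rw [abs_neg, abs_of_nonneg hM0]) hwb)
  have hmain := meanSeminorm_le_add_outerExp_abs_sub (P := P)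
    (f := fun ω => f (Z ω) - ∑ i, f (φ.center i) * c i) (hfb.sub (.const _)) hsb
  linarith [meanSeminorm_sum_mul_le (P := P) (fun i => hM (φ.center i)) hwb]

lemma abs_outerExp_comp_sub_le (φ : BumpFamily ι D δ) {f : D → ℝ} {M ε : ℝ}
    (hM : ∀ x, |f x| ≤ M) (hf : ∀ i x, dist (φ.center i) x < δ → |f (φ.center i) - f x| ≤ ε)
    (hε : 0 ≤ ε) (X : Ω → D) (Y : Ω' → D) (c : ι → ℝ) :
    |outerExp P (fun ω => f (X ω)) - outerExp Q (fun ω => f (Y ω))|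
      ≤ 2 * ε + 2 * M * (1 - ∑ i, c i)
        + 2 * M * ∑ i, (meanSeminorm P (fun ω => φ.weight i (X ω) - c i)
          + meanSeminorm Q fun ω => φ.weight i (Y ω) - c i) := by
  have hX := (abs_outerExp_sub_le_meanSeminorm ⟨M, fun ω => hM (X ω)⟩ _).trans
    (φ.meanSeminorm_sub_sum_le (P := P) hM hf hε X c)
  have hY := (abs_outerExp_sub_le_meanSeminorm ⟨M, fun ω => hM (Y ω)⟩ _).trans
    (φ.meanSeminorm_sub_sum_le (P := Q) hM hf hε Y c)
  rw [abs_sub_comm] at hY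
  rw [Finset.sum_add_distrib]
  linarith [abs_sub_le (outerExp P fun ω => f (X ω)) (∑ i, f (φ.center i) * c i)
    (outerExp Q fun ω => f (Y ω))]

end Means

end BumpFamily

section Tightness

variable {D : Type*} [MeasurableSpace D] {L : Measure D}

lemma exists_isCompact_measureReal_compl_le [TopologicalSpace D] (hL : IsTightMeasureSet {L})
    {ε : ℝ} (hε : 0 < ε) : ∃ K : Set D, IsCompact K ∧ L.real Kᶜ ≤ ε := by
  obtain ⟨K, hK, h⟩ := isTightMeasureSet_iff_exists_isCompact_measure_compl_le.1 hL
    (ENNReal.ofReal ε) (by simpa)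
  exact ⟨K, hK, ENNReal.toReal_le_of_le_ofReal hε.le (h L rfl)⟩

lemma BumpFamily.one_sub_sum_integral_le [PseudoMetricSpace D] [OpensMeasurableSpace D]
    [IsProbabilityMeasure L] {ι : Type*} [Fintype ι] {δ : ℝ} (φ : BumpFamily ι D δ) {K : Set D}
    (hK : ∀ y ∈ K, ∑ i, φ.weight i y = 1) : 1 - ∑ i, ∫ y, φ.weight i y ∂L ≤ L.real Kᶜ := by
  -- `K` need not be measurable, so the defect `1 - ∑ i, φ i` is compared with its open support.
  set U : Set D := {y | ∑ i, φ.weight i y ≠ 1} with hU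
  have hUm : MeasurableSet U :=
    (isOpen_ne_fun (continuous_finsetSum _ fun i _ => (φ.weight i).continuous)
      continuous_const).measurableSet
  have hi : ∀ i, Integrable (fun y => φ.weight i y) L := fun i => (φ.weight i).integrable L
  have hle := integral_mono (μ := L) ((integrable_const (1 : ℝ)).sub
    (integrable_finsetSum Finset.univ fun i _ => hi i))
    ((integrable_const (1 : ℝ)).indicator hUm) fun y => by
      by_cases hy : ∑ i, φ.weight i y = 1
      · simp [hU, hy]
      · simp [hU, hy, Finset.sum_nonneg fun i _ => φ.weight_nonneg i y]
  rw [integral_indicator_const _ hUm,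
    integral_sub' (integrable_const _) (integrable_finsetSum Finset.univ fun i _ => hi i),
    integral_finsetSum _ fun i _ => hi i] at hle
  refine le_trans (by simpa using hle) (measureReal_mono (s₁ := U) fun y hy hyK => hy (hK y hyK))

end Tightness

section BoundedLipschitzDistance

variable {D Ω Ω' : Type*} [PseudoMetricSpace D] [MeasurableSpace Ω] [MeasurableSpace Ω']
  {P : Measure Ω} {Q : Measure Ω'} {X : Ω → D} {Y : Ω' → D}

lemma boundedLipschitzDist_nonneg : 0 ≤ boundedLipschitzDist P X Q Y :=
  Real.iSup_nonneg fun _ => abs_nonneg _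

lemma boundedLipschitzDist_le {c : ℝ}
    (hc : ∀ h ∈ BL1 D, |outerExp P (fun ω => h (X ω)) - outerExp Q (fun ω => h (Y ω))| ≤ c) :
    boundedLipschitzDist P X Q Y ≤ c :=
  have : Nonempty (BL1 D) := ⟨⟨fun _ => 0, LipschitzWith.const' 0, by simp⟩⟩
  ciSup_le fun h => hc h h.2

variable [IsProbabilityMeasure P] [IsProbabilityMeasure Q]

lemma abs_outerExp_sub_le_two {h : D → ℝ} (hh : h ∈ BL1 D) :
    |outerExp P (fun ω => h (X ω)) - outerExp Q (fun ω => h (Y ω))| ≤ 2 := by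
  have hX := abs_outerExp_le (P := P) (f := fun ω => h (X ω)) fun ω => hh.2 _
  have hY := abs_outerExp_le (P := Q) (f := fun ω => h (Y ω)) fun ω => hh.2 _
  exact (abs_sub _ _).trans (by linarith)

lemma abs_boundedLipschitzDist_le_two : |boundedLipschitzDist P X Q Y| ≤ 2 :=
  (abs_of_nonneg boundedLipschitzDist_nonneg).trans_le
    (boundedLipschitzDist_le fun _ => abs_outerExp_sub_le_two)

lemma le_boundedLipschitzDist {h : D → ℝ} (hh : h ∈ BL1 D) :
    |outerExp P (fun ω => h (X ω)) - outerExp Q (fun ω => h (Y ω))|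
      ≤ boundedLipschitzDist P X Q Y :=
  le_ciSup (f := fun h : BL1 D =>
      |outerExp P (fun ω => h.1 (X ω)) - outerExp Q (fun ω => h.1 (Y ω))|)
    ⟨2, Set.forall_mem_range.2 fun g => abs_outerExp_sub_le_two g.2⟩ ⟨h, hh⟩

lemma abs_outerExp_sub_le_mul_boundedLipschitzDist {h : D → ℝ} {C : NNReal}
    (hC : LipschitzWith C h) (hh : ∀ x, |h x| ≤ 1) :
    |outerExp P (fun ω => h (X ω)) - outerExp Q (fun ω => h (Y ω))|
      ≤ max C 1 * boundedLipschitzDist P X Q Y := by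
  set r : ℝ := max (C : ℝ) 1
  have hr1 : 1 ≤ r := le_max_right _ _
  have hr0 : 0 < r := one_pos.trans_le hr1
  have hmem : (fun x => r⁻¹ * h x) ∈ BL1 D := by
    refine ⟨LipschitzWith.of_dist_le_mul fun x y => ?_, fun x => ?_⟩
    · rw [NNReal.coe_one, one_mul, Real.dist_eq, ← mul_sub, abs_mul, abs_inv, abs_of_pos hr0,
        inv_mul_le_iff₀ hr0, ← Real.dist_eq]
      exact (hC.dist_le_mul x y).trans (mul_le_mul_of_nonneg_right (le_max_left _ _) dist_nonneg)
    · rw [abs_mul, abs_inv, abs_of_pos hr0, inv_mul_le_iff₀ hr0, mul_one]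
      exact (hh x).trans hr1
  have h := le_boundedLipschitzDist (P := P) (Q := Q) (X := X) (Y := Y) hmem
  rwa [outerExp_const_mul (inv_pos.2 hr0) ⟨1, fun ω => hh (X ω)⟩,
    outerExp_const_mul (inv_pos.2 hr0) ⟨1, fun ω => hh (Y ω)⟩, ← mul_sub, abs_mul, abs_inv,
    abs_of_pos hr0, inv_mul_le_iff₀ hr0] at h

lemma meanSeminorm_sub_le_mul_boundedLipschitzDist {h : D → ℝ} {C : NNReal}
    (hC : LipschitzWith C h) (hh : ∀ x, |h x| ≤ 1) (c : ℝ) :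
    meanSeminorm P (fun ω => h (X ω) - c)
      ≤ max C 1 * boundedLipschitzDist P X Q Y + meanSeminorm Q fun ω => h (Y ω) - c := by
  refine (meanSeminorm_sub_le (Q := Q) ⟨1, fun ω => hh (X ω)⟩ ⟨1, fun ω => hh (Y ω)⟩ c).trans
    (add_le_add (max_le (abs_outerExp_sub_le_mul_boundedLipschitzDist hC hh) ?_) le_rfl)
  exact abs_outerExp_sub_le_mul_boundedLipschitzDist hC.neg fun x => (abs_neg _).trans_le (hh x)

lemma condMeanSeminorm_sub_le_mul_outerExp_boundedLipschitzDist {Z : Ω × Ω' → D} {h : D → ℝ}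
    {C : NNReal} (hC : LipschitzWith C h) (hh : ∀ x, |h x| ≤ 1) (c : ℝ) :
    condMeanSeminorm P Q (fun p => h (Z p) - c)
      ≤ meanSeminorm P (fun ω => h (X ω) - c) + max C 1 *
        outerExp P fun ω => |boundedLipschitzDist Q (fun ω' => Z (ω, ω')) P X| := by
  have hd : IsBoundedFun fun ω => |boundedLipschitzDist Q (fun ω' => Z (ω, ω')) P X| :=
    IsBoundedFun.abs ⟨2, fun ω => abs_boundedLipschitzDist_le_two⟩
  have hCd := (IsBoundedFun.const (max C 1 : NNReal)).mul hd
  have hb : IsBoundedFun fun p => h (Z p) - c := .sub ⟨1, fun p => hh _⟩ (.const c)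
  refine (outerExp_mono hb.meanSeminorm_section ((IsBoundedFun.const
    (meanSeminorm P fun ω => h (X ω) - c)).add hCd) fun ω => ?_).trans ?_
  · rw [abs_of_nonneg boundedLipschitzDist_nonneg, add_comm]
    exact meanSeminorm_sub_le_mul_boundedLipschitzDist hC hh c
  · rw [outerExp_const_add _ hCd]
    exact add_le_add le_rfl (outerExp_const_mul_le (max C 1).coe_nonneg hd)

lemma BumpFamily.boundedLipschitzDist_le {ι : Type*} [Fintype ι] {δ : ℝ} (φ : BumpFamily ι D δ)
    (hδ : 0 ≤ δ) (c : ι → ℝ) :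
    boundedLipschitzDist P X Q Y ≤ 2 * δ + 2 * (1 - ∑ i, c i)
      + 2 * ∑ i, (meanSeminorm P (fun ω => φ.weight i (X ω) - c i)
        + meanSeminorm Q fun ω => φ.weight i (Y ω) - c i) := by
  refine _root_.boundedLipschitzDist_le fun h hh => ?_
  have hosc : ∀ i x, dist (φ.center i) x < δ → |h (φ.center i) - h x| ≤ δ := fun i x hx => by
    simpa [Real.dist_eq] using (hh.1.dist_le_mul (φ.center i) x).trans (by simpa using hx.le)
  simpa only [mul_one] using φ.abs_outerExp_comp_sub_le (P := P) (Q := Q) hh.2 hosc hδ X Y c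

lemma BumpFamily.outerExp_abs_boundedLipschitzDist_le {ι : Type*} [Fintype ι] {δ : ℝ}
    (φ : BumpFamily ι D δ) (hδ : 0 ≤ δ) (c : ι → ℝ) {Z : Ω × Ω' → D} :
    outerExp P (fun ω => |boundedLipschitzDist Q (fun ω' => Z (ω, ω')) P X|)
      ≤ 2 * δ + 2 * (1 - ∑ i, c i)
        + 2 * ∑ i, (meanSeminorm P (fun ω => φ.weight i (X ω) - c i)
          + condMeanSeminorm P Q fun p => φ.weight i (Z p) - c i) := by
  have hw : ∀ i, IsBoundedFun fun ω => meanSeminorm Q fun ω' => φ.weight i (Z (ω, ω')) - c i :=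
    fun i => ((IsBoundedFun.bcf (φ.weight i) Z).sub (.const (c i))).meanSeminorm_section
  have hsum := (IsBoundedFun.const 2).mul (.sum (s := Finset.univ) hw)
  refine (outerExp_mono (IsBoundedFun.abs ⟨2, fun ω => abs_boundedLipschitzDist_le_two⟩)
    ((IsBoundedFun.const (2 * δ + 2 * (1 - ∑ i, c i)
      + 2 * ∑ i, meanSeminorm P (fun ω => φ.weight i (X ω) - c i))).add hsum) fun ω => ?_).trans ?_
  · rw [abs_of_nonneg boundedLipschitzDist_nonneg]
    have h := φ.boundedLipschitzDist_le (P := Q) (Q := P) (X := fun ω' => Z (ω, ω')) (Y := X) hδ c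
    rw [Finset.sum_add_distrib] at h
    linarith
  · have h := (outerExp_const_mul_le (P := P) zero_le_two (.sum (s := Finset.univ) hw)).trans
      (mul_le_mul_of_nonneg_left (outerExp_sum_le Finset.univ hw) zero_le_two)
    rw [outerExp_const_add _ hsum, Finset.sum_add_distrib]
    simp only [condMeanSeminorm]
    linarith

end BoundedLipschitzDistance

section Asymptotics

lemma tendsto_zero_of_forall_le_mul_add {ι : Type*} {l : Filter ι} {x : ι → ℝ} {C : ℝ}
    (hx : ∀ n, 0 ≤ x n) (hC : 0 < C)
    (h : ∀ ε > 0, ∃ y : ι → ℝ, Tendsto y l (𝓝 0) ∧ ∀ n, x n ≤ C * ε + y n) :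
    Tendsto x l (𝓝 0) := by
  refine tendsto_order.2 ⟨fun a ha => .of_forall fun n => ha.trans_le (hx n), fun a ha => ?_⟩
  obtain ⟨y, hy, hxy⟩ := h (a / (2 * C)) (by positivity)
  filter_upwards [hy.eventually_lt_const (half_pos ha)] with n hn
  have hCa : C * (a / (2 * C)) = a / 2 := by field_simp
  linarith [hxy n]

variable {Ω Ω' : ℕ → Type*} [∀ n, MeasurableSpace (Ω n)] [∀ n, MeasurableSpace (Ω' n)]
  {P : ∀ n, Measure (Ω n)} [∀ n, IsProbabilityMeasure (P n)]
  {Q : ∀ n, Measure (Ω' n)} [∀ n, IsProbabilityMeasure (Q n)]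

lemma tendstoZeroInOuterProb_iff {Z : ∀ n, Ω n → ℝ} {M : ℝ}
    (hZ : ∀ n ω, |Z n ω| ≤ M) :
    TendstoZeroInOuterProb P Z
      ↔ Tendsto (fun n => outerExp (P n) fun ω => |Z n ω|) atTop (𝓝 0) := by
  have hb : ∀ n, IsBoundedFun (Z n) := fun n => ⟨M, hZ n⟩
  refine ⟨fun h => tendsto_zero_of_forall_le_mul_add
    (fun n => outerExp_nonneg (hb n).abs fun _ => abs_nonneg _) one_pos fun ε hε =>
      ⟨fun n => M * (P n).real {ω | ε < |Z n ω|}, ?_, fun n => ?_⟩, fun h ε hε => ?_⟩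
  · simpa [measureReal_def] using
      ((ENNReal.tendsto_toReal ENNReal.zero_ne_top).comp (h ε hε)).const_mul M
  · rw [one_mul]
    exact outerExp_abs_le_add_measureReal hε.le (hZ n)
  · refine tendsto_of_tendsto_of_tendsto_of_le_of_le tendsto_const_nhds ?_ (fun _ => zero_le)
      fun n => measure_lt_abs_le hε (hb n)
    simpa using ENNReal.tendsto_ofReal (h.div_const ε)

lemma WeaklyConverges.tendsto_meanSeminorm {D : Type*} [TopologicalSpace D] [MeasurableSpace D]
    {L : Measure D} {G : ∀ n, Ω n → D} (hG : WeaklyConverges P G L) (h : D →ᵇ ℝ) :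
    Tendsto (fun n => meanSeminorm (P n) fun ω => h (G n ω) - ∫ y, h y ∂L) atTop (𝓝 0) := by
  have hneg : Tendsto (fun n => outerExp (P n) fun ω => -h (G n ω)) atTop (𝓝 (-∫ y, h y ∂L)) := by
    simpa [integral_neg] using hG (-h)
  simp only [meanSeminorm_sub_const (.bcf h _)]
  simpa using ((hG h).sub_const (∫ y, h y ∂L)).max (hneg.add_const (∫ y, h y ∂L))

lemma RelativelyWeaklyConvergent.tendsto_meanSeminorm {D : Type*} [TopologicalSpace D]
    {X : ∀ n, Ω n → D} {Y : ∀ n, Ω' n → D} (hXY : RelativelyWeaklyConvergent P X Q Y)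
    (h : D →ᵇ ℝ) {c : ℝ}
    (hY : Tendsto (fun n => meanSeminorm (Q n) fun ω => h (Y n ω) - c) atTop (𝓝 0)) :
    Tendsto (fun n => meanSeminorm (P n) fun ω => h (X n ω) - c) atTop (𝓝 0) := by
  refine squeeze_zero (fun n => meanSeminorm_nonneg ((IsBoundedFun.bcf h _).sub (.const c)))
    (fun n => meanSeminorm_sub_le (P := P n) (Q := Q n) (.bcf h (X n)) (.bcf h (Y n)) c) ?_
  simpa using ((hXY h).max (hXY (-h))).add hY

lemma asymptoticallyMeasurable_of_tendsto_meanSeminorm {D : Type*} [TopologicalSpace D]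
    {X : ∀ n, Ω n → D} (hX : ∀ h : D →ᵇ ℝ, ∃ c : ℝ,
      Tendsto (fun n => meanSeminorm (P n) fun ω => h (X n ω) - c) atTop (𝓝 0)) :
    AsymptoticallyMeasurable P X := fun h => by
  obtain ⟨c, hc⟩ := hX h
  refine squeeze_zero (fun n => sub_nonneg.2 (innerExp_le_outerExp (.bcf h _)))
    (fun n => outerExp_sub_innerExp_le (.bcf h _) c) ?_
  simpa using hc.const_mul 2

omit [∀ n, IsProbabilityMeasure (P n)] in
lemma RelativelyCompact.tendsto_of_weaklyConverges {D : Type*} [TopologicalSpace D]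
    [MeasurableSpace D] {G : ∀ n, Ω n → D} (hrc : RelativelyCompact P G) {β : Type*}
    {l : Filter β} {x : ℕ → β}
    (h : ∀ (σ : ℕ → ℕ) (L : Measure D), StrictMono σ → IsProbabilityMeasure L →
      IsTightMeasureSet {L} → WeaklyConverges (fun k => P (σ k)) (fun k => G (σ k)) L →
      Tendsto (fun k => x (σ k)) atTop l) : Tendsto x atTop l := by
  refine tendsto_of_subseq_tendsto fun ns hns => ?_
  obtain ⟨φ, -, hnsφ⟩ := strictMono_subseq_of_tendsto_atTop hns
  obtain ⟨ψ, hψ, L, hLp, hLt, hLw⟩ := hrc (ns ∘ φ) hnsφ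
  exact ⟨φ ∘ ψ, h _ L (hnsφ.comp hψ) hLp hLt hLw⟩

/-- The real functions `Z n` on the product spaces have means close to `c`, and so do their
sections for most values of the first coordinate: the form in which the conditional means of the
bootstrap statistics converge in probability, without any measurability of `Z n`. -/
structure ConditionalMeanTendsto (P : ∀ n, Measure (Ω n)) (Q : ∀ n, Measure (Ω' n))
    (Z : ∀ n, Ω n × Ω' n → ℝ) (c : ℝ) : Prop where
  tendsto_mean : Tendsto (fun n => meanSeminorm ((P n).prod (Q n)) fun p => Z n p - c) atTop (𝓝 0)
  tendsto_condMean : Tendsto (fun n => condMeanSeminorm (P n) (Q n) fun p => Z n p - c) atTop (𝓝 0)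

namespace ConditionalMeanTendsto

lemma comp_snd {f : ∀ n, Ω' n → ℝ} {c : ℝ} (hfb : ∀ n, IsBoundedFun (f n))
    (hf : Tendsto (fun n => meanSeminorm (Q n) fun ω => f n ω - c) atTop (𝓝 0)) :
    ConditionalMeanTendsto P Q (fun n p => f n p.2) c where
  tendsto_mean := squeeze_zero
    (fun n => meanSeminorm_nonneg (((hfb n).comp Prod.snd).sub (.const c)))
    (fun n => meanSeminorm_comp_le measurePreserving_snd ((hfb n).sub (.const c))) hf
  tendsto_condMean := by
    simpa only [condMeanSeminorm_comp_snd (P := P _) (fun ω => f _ ω - c)] using hf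

lemma tendsto_meanSeminorm_mul {f : ∀ n, Ω n → ℝ} {g h : ∀ n, Ω n × Ω' n → ℝ} {a b c : ℝ}
    (hf : Tendsto (fun n => meanSeminorm (P n) fun ω => f n ω - a) atTop (𝓝 0))
    (hg : ConditionalMeanTendsto P Q g b) (hh : ConditionalMeanTendsto P Q h c)
    (hf1 : ∀ n ω, |f n ω| ≤ 1) (hg1 : ∀ n p, |g n p| ≤ 1) (hh1 : ∀ n p, |h n p| ≤ 1)
    (hb : |b| ≤ 1) (hc : |c| ≤ 1) :
    Tendsto (fun n => meanSeminorm ((P n).prod ((Q n).prod (Q n)))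
      fun p => f n p.1 * (g n (p.1, p.2.1) * h n (p.1, p.2.2)) - a * (b * c)) atTop (𝓝 0) := by
  refine squeeze_zero (fun n => meanSeminorm_nonneg (.sub ⟨1, fun p =>
    abs_mul_le_one (hf1 n _) (abs_mul_le_one (hg1 n _) (hh1 n _))⟩ (.const _)))
    (fun n => meanSeminorm_mul_sections_sub_le (hf1 n) (hg1 n) (hh1 n) hb hc) ?_
  simpa using ((hf.const_mul 5).add (hg.tendsto_condMean.add (hg.tendsto_mean.const_mul 4))).add
    (hh.tendsto_condMean.add (hh.tendsto_mean.const_mul 4))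

lemma of_tendsto_mul {g : ∀ n, Ω n × Ω' n → ℝ} {b : ℝ}
    (hg1 : ∀ n p, |g n p| ≤ 1) (hb : |b| ≤ 1)
    (hg : Tendsto (fun n => meanSeminorm ((P n).prod (Q n)) fun p => g n p - b) atTop (𝓝 0))
    (hgg : Tendsto (fun n => meanSeminorm ((P n).prod ((Q n).prod (Q n)))
      fun p => g n (p.1, p.2.1) * g n (p.1, p.2.2) - b * b) atTop (𝓝 0)) :
    ConditionalMeanTendsto P Q g b where
  tendsto_mean := hg
  tendsto_condMean := squeeze_zero
    (fun n => condMeanSeminorm_nonneg (.sub ⟨1, hg1 n⟩ (.const b)))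
    (fun n => condMeanSeminorm_sub_le_sqrt (hg1 n) hb) <| by
      simpa using (hg.const_mul 2).add (hgg.add (hg.const_mul 10)).sqrt

lemma of_boundedLipschitzDist {D : Type*} [PseudoMetricSpace D] {G : ∀ n, Ω n → D}
    {Gb : ∀ n, Ω n × Ω' n → D}
    (hd : TendstoZeroInOuterProb P
      fun n ω => boundedLipschitzDist (Q n) (fun ω' => Gb n (ω, ω')) (P n) (G n))
    (hm : AsymptoticallyMeasurable (fun n => (P n).prod (Q n)) Gb) {h : D →ᵇ ℝ} {c : ℝ}
    (hG : Tendsto (fun n => meanSeminorm (P n) fun ω => h (G n ω) - c) atTop (𝓝 0))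
    (hh1 : ∀ y, |h y| ≤ 1) {C : NNReal} (hC : LipschitzWith C h) :
    ConditionalMeanTendsto P Q (fun n p => h (Gb n p)) c := by
  have hb : ∀ n, IsBoundedFun fun p => h (Gb n p) - c := fun n =>
    (IsBoundedFun.bcf h _).sub (.const c)
  rw [tendstoZeroInOuterProb_iff fun n ω => abs_boundedLipschitzDist_le_two] at hd
  have hcond : Tendsto (fun n => condMeanSeminorm (P n) (Q n) fun p => h (Gb n p) - c)
      atTop (𝓝 0) := by
    refine squeeze_zero (fun n => condMeanSeminorm_nonneg (hb n))
      (fun n => condMeanSeminorm_sub_le_mul_outerExp_boundedLipschitzDist (X := G n) hC hh1 c) ?_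
    simpa using hG.add (hd.const_mul _)
  refine ⟨squeeze_zero (fun n => meanSeminorm_nonneg (hb n))
    (fun n => meanSeminorm_prod_le (hb n)) ?_, hcond⟩
  simpa using hcond.add ((hm (h - BoundedContinuousFunction.const D c)).const_mul 2)

end ConditionalMeanTendsto

end Asymptotics

section Bootstrap

lemma one_sub_sum_mul_mul_le {ι : Type*} [Fintype ι] {m : ι → ℝ} (hm : 0 ≤ ∑ i, m i) :
    1 - ∑ q : ι × ι × ι, m q.1 * (m q.2.1 * m q.2.2) ≤ 3 * (1 - ∑ i, m i) := by
  have hcube := one_add_mul_sub_le_pow (a := ∑ i, m i) (by linarith) 3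
  have hprod : ∑ q : ι × ι × ι, m q.1 * (m q.2.1 * m q.2.2) = (∑ i, m i) ^ 3 := by
    simp only [Fintype.sum_prod_type, ← Finset.mul_sum, ← Finset.sum_mul, pow_three]
  push_cast at hcube
  linarith

variable {Ω Ω' : ℕ → Type*} [∀ n, MeasurableSpace (Ω n)] [∀ n, MeasurableSpace (Ω' n)]
  {P : ∀ n, Measure (Ω n)} [∀ n, IsProbabilityMeasure (P n)]
  {Q : ∀ n, Measure (Ω' n)} [∀ n, IsProbabilityMeasure (Q n)]
  {D : Type*} [PseudoMetricSpace D] [MeasurableSpace D]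
  {L : Measure D} [IsProbabilityMeasure L] {G : ∀ n, Ω n → D} {Gb : ∀ n, Ω n × Ω' n → D}

lemma BumpFamily.tendsto_meanSeminorm_prod {ι : Type*} [Fintype ι] {δ : ℝ} (φ : BumpFamily ι D δ)
    (hG : WeaklyConverges P G L)
    (hc : ∀ i, ConditionalMeanTendsto P Q (fun n p => φ.weight i (Gb n p)) (∫ y, φ.weight i y ∂L))
    (q : ι × ι × ι) :
    Tendsto (fun n => meanSeminorm ((P n).prod ((Q n).prod (Q n))) fun p =>
      (φ.prod (φ.prod φ)).weight q (G n p.1, Gb n (p.1, p.2.1), Gb n (p.1, p.2.2))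
        - (∫ y, φ.weight q.1 y ∂L) * ((∫ y, φ.weight q.2.1 y ∂L) * ∫ y, φ.weight q.2.2 y ∂L))
      atTop (𝓝 0) := by
  have hm : ∀ i, |∫ y, φ.weight i y ∂L| ≤ 1 := fun i =>
    abs_integral_le_of_forall_abs_le (φ.abs_weight_le_one i)
  simpa only [weight_prod_apply] using ConditionalMeanTendsto.tendsto_meanSeminorm_mul
    (hG.tendsto_meanSeminorm (φ.weight q.1)) (hc q.2.1) (hc q.2.2)
    (fun n ω => φ.abs_weight_le_one q.1 (G n ω)) (fun n p => φ.abs_weight_le_one q.2.1 (Gb n p))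
    (fun n p => φ.abs_weight_le_one q.2.2 (Gb n p)) (hm q.2.1) (hm q.2.2)

theorem tendsto_outerExp_abs_boundedLipschitzDist [OpensMeasurableSpace D]
    (hL : IsTightMeasureSet {L}) (hG : WeaklyConverges P G L)
    (hc : ∀ h : D →ᵇ ℝ, (∀ y, |h y| ≤ 1) →
      ConditionalMeanTendsto P Q (fun n p => h (Gb n p)) (∫ y, h y ∂L)) :
    Tendsto (fun n => outerExp (P n) fun ω =>
      |boundedLipschitzDist (Q n) (fun ω' => Gb n (ω, ω')) (P n) (G n)|) atTop (𝓝 0) := by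
  refine tendsto_zero_of_forall_le_mul_add (C := 4) (fun n => outerExp_nonneg
    (IsBoundedFun.abs ⟨2, fun ω => abs_boundedLipschitzDist_le_two⟩) fun _ => abs_nonneg _)
    four_pos fun ε hε => ?_
  obtain ⟨K, hK, hKε⟩ := exists_isCompact_measureReal_compl_le hL hε
  obtain ⟨ι, _, φ, -, -, hφK⟩ := BumpFamily.exists_lipschitzWith_of_isCompact hK hε
  refine ⟨_, ?_, fun n => (φ.outerExp_abs_boundedLipschitzDist_le hε.le
    (fun i => ∫ y, φ.weight i y ∂L)).trans (add_le_add ?_ le_rfl)⟩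
  · simpa using (tendsto_finsetSum Finset.univ fun i _ => (hG.tendsto_meanSeminorm (φ.weight i)).add
      (hc _ (φ.abs_weight_le_one i)).tendsto_condMean).const_mul 2
  · linarith [φ.one_sub_sum_integral_le (L := L) hφK]

theorem relativelyWeaklyConvergent_of_conditionalMeanTendsto [OpensMeasurableSpace D]
    (hL : IsTightMeasureSet {L}) (hG : WeaklyConverges P G L)
    (hc : ∀ h : D →ᵇ ℝ, (∀ y, |h y| ≤ 1) → (∃ C, LipschitzWith C h) →
      ConditionalMeanTendsto P Q (fun n p => h (Gb n p)) (∫ y, h y ∂L)) :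
    RelativelyWeaklyConvergent (fun n => (P n).prod ((Q n).prod (Q n)))
      (fun n p => (G n p.1, Gb n (p.1, p.2.1), Gb n (p.1, p.2.2)))
      (fun n => (P n).prod ((P n).prod (P n))) (fun n p => (G n p.1, G n p.2.1, G n p.2.2)) := by
  intro f
  refine tendsto_zero_of_forall_le_mul_add (C := 2 + 6 * ‖f‖) (fun n => abs_nonneg _)
    (by positivity) fun ε hε => ?_
  obtain ⟨K, hK, hKε⟩ := exists_isCompact_measureReal_compl_le hL hε
  obtain ⟨δ, hδ, hfδ⟩ := Metric.mem_uniformity_dist.1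
    ((hK.prod (hK.prod hK)).uniformContinuousAt_of_continuousAt f
      (fun _ _ => f.continuous.continuousAt) (Metric.dist_mem_uniformity hε))
  obtain ⟨ι, _, φ, hφcenter, hφlip, hφK⟩ := BumpFamily.exists_lipschitzWith_of_isCompact hK hδ
  set m : ι → ℝ := fun i => ∫ y, φ.weight i y ∂L
  have hosc : ∀ q y, dist ((φ.prod (φ.prod φ)).center q) y < δ →
      |f ((φ.prod (φ.prod φ)).center q) - f y| ≤ ε := fun q y hqy =>
    (hfδ hqy ⟨hφcenter _, hφcenter _, hφcenter _⟩ : dist _ _ < ε).le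
  have hb := φ.tendsto_meanSeminorm_prod hG fun i => hc _ (φ.abs_weight_le_one i) (hφlip i)
  have hp := φ.tendsto_meanSeminorm_prod (Q := P) (Gb := fun n p => G n p.2) hG fun i =>
    .comp_snd (fun n => .bcf _ _) (hG.tendsto_meanSeminorm (φ.weight i))
  refine ⟨_, ?_, fun n => ((φ.prod (φ.prod φ)).abs_outerExp_comp_sub_le f.norm_coe_le_norm hosc
    hε.le _ _ fun q => m q.1 * (m q.2.1 * m q.2.2)).trans (add_le_add ?_ le_rfl)⟩
  · simpa using (tendsto_finsetSum Finset.univ fun q _ => (hb q).add (hp q)).const_mul (2 * ‖f‖)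
  · have hsum0 : 0 ≤ ∑ i, m i :=
      Finset.sum_nonneg fun i _ => integral_nonneg (φ.weight_nonneg i)
    have hdefect : 1 - ∑ q : ι × ι × ι, m q.1 * (m q.2.1 * m q.2.2) ≤ 3 * ε :=
      (one_sub_sum_mul_mul_le hsum0).trans
        (by linarith [φ.one_sub_sum_integral_le (L := L) hφK])
    nlinarith [mul_le_mul_of_nonneg_left hdefect (norm_nonneg f)]

section Joint

variable (hG : WeaklyConverges P G L)
  (hj : RelativelyWeaklyConvergent (fun n => (P n).prod ((Q n).prod (Q n)))
    (fun n p => (G n p.1, Gb n (p.1, p.2.1), Gb n (p.1, p.2.2)))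
    (fun n => (P n).prod ((P n).prod (P n))) (fun n p => (G n p.1, G n p.2.1, G n p.2.2)))
include hG hj

omit [IsProbabilityMeasure L] in
lemma tendsto_meanSeminorm_of_joint (h : D →ᵇ ℝ) :
    Tendsto (fun n => meanSeminorm ((P n).prod (Q n)) fun p => h (Gb n p) - ∫ y, h y ∂L)
      atTop (𝓝 0) := by
  have hY : Tendsto (fun n => meanSeminorm ((P n).prod ((P n).prod (P n)))
      fun p => h (G n p.2.1) - ∫ y, h y ∂L) atTop (𝓝 0) :=
    squeeze_zero (fun n => meanSeminorm_nonneg (.sub (.bcf h _) (.const _)))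
      (fun n => meanSeminorm_comp_le (measurePreserving_fst.comp measurePreserving_snd)
        (.sub (.bcf h (G n)) (.const _))) (hG.tendsto_meanSeminorm h)
  have hX := hj.tendsto_meanSeminorm
    (h.compContinuous ⟨fun y => y.2.1, continuous_fst.comp continuous_snd⟩) hY
  exact hX.congr fun n =>
    meanSeminorm_comp_fst_snd_fst ((IsBoundedFun.bcf h (Gb n)).sub (.const _))

lemma conditionalMeanTendsto_of_joint {h : D →ᵇ ℝ} (hh : ∀ y, |h y| ≤ 1) :
    ConditionalMeanTendsto P Q (fun n p => h (Gb n p)) (∫ y, h y ∂L) := by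
  have hm : |∫ y, h y ∂L| ≤ 1 := abs_integral_le_of_forall_abs_le hh
  have hc : ConditionalMeanTendsto P P (fun n p => h (G n p.2)) (∫ y, h y ∂L) :=
    .comp_snd (fun n => .bcf h _) (hG.tendsto_meanSeminorm h)
  have hY : Tendsto (fun n => meanSeminorm ((P n).prod ((P n).prod (P n)))
      fun p => h (G n p.2.1) * h (G n p.2.2) - (∫ y, h y ∂L) * ∫ y, h y ∂L) atTop (𝓝 0) := by
    simpa using ConditionalMeanTendsto.tendsto_meanSeminorm_mul (P := P) (f := fun _ _ => 1)
      (a := 1) (by simp [meanSeminorm_zero]) hc hc (by simp)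
      (fun n p => hh (G n p.2)) (fun n p => hh (G n p.2)) hm hm
  refine .of_tendsto_mul (fun n p => hh (Gb n p)) hm (tendsto_meanSeminorm_of_joint hG hj h) ?_
  let F : D × D × D →ᵇ ℝ :=
    h.compContinuous ⟨fun y => y.2.1, continuous_fst.comp continuous_snd⟩ *
      h.compContinuous ⟨fun y => y.2.2, continuous_snd.comp continuous_snd⟩
  exact hj.tendsto_meanSeminorm F hY

end Joint

end Bootstrap

theorem mainTheorem9_general {Ω Ω' : ℕ → Type*} [∀ n, MeasurableSpace (Ω n)]
    [∀ n, MeasurableSpace (Ω' n)] {D : Type*} [PseudoMetricSpace D] [MeasurableSpace D]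
    [OpensMeasurableSpace D] (P : ∀ n, Measure (Ω n)) [∀ n, IsProbabilityMeasure (P n)]
    (Q : ∀ n, Measure (Ω' n)) [∀ n, IsProbabilityMeasure (Q n)] (G : ∀ n, Ω n → D)
    (Gb : ∀ n, Ω n × Ω' n → D) (hrc : RelativelyCompact P G) :
    (TendstoZeroInOuterProb P
        (fun n ω => boundedLipschitzDist (Q n) (fun ω₁ => Gb n (ω, ω₁)) (P n) (G n)) ∧
      AsymptoticallyMeasurable (fun n => (P n).prod (Q n)) Gb) ↔
    RelativelyWeaklyConvergent (fun n => (P n).prod ((Q n).prod (Q n)))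
      (fun n p => (G n p.1, Gb n (p.1, p.2.1), Gb n (p.1, p.2.2)))
      (fun n => (P n).prod ((P n).prod (P n))) (fun n p => (G n p.1, G n p.2.1, G n p.2.2)) := by
  constructor
  · rintro ⟨hd, hm⟩ f
    refine hrc.tendsto_of_weaklyConverges fun σ L hσ hLp hLt hLw => ?_
    have hd' := fun ε hε => (hd ε hε).comp hσ.tendsto_atTop
    have hm' := fun g => (hm g).comp hσ.tendsto_atTop
    exact relativelyWeaklyConvergent_of_conditionalMeanTendsto (Q := fun k => Q (σ k))
      (Gb := fun k => Gb (σ k)) hLt hLw (fun h hh ⟨C, hC⟩ =>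
        .of_boundedLipschitzDist hd' hm' (hLw.tendsto_meanSeminorm h) hh hC) f
  · intro hj
    have hj' := fun (σ : ℕ → ℕ) (hσ : StrictMono σ) f => (hj f).comp hσ.tendsto_atTop
    constructor
    · rw [tendstoZeroInOuterProb_iff fun n ω => abs_boundedLipschitzDist_le_two]
      refine hrc.tendsto_of_weaklyConverges fun σ L hσ hLp hLt hLw => ?_
      exact tendsto_outerExp_abs_boundedLipschitzDist (Q := fun k => Q (σ k))
        (Gb := fun k => Gb (σ k)) hLt hLw fun h hh =>
          conditionalMeanTendsto_of_joint hLw (hj' σ hσ) hh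
    · intro f
      refine hrc.tendsto_of_weaklyConverges fun σ L hσ _ _ hLw => ?_
      exact asymptoticallyMeasurable_of_tendsto_meanSeminorm
        (P := fun k => (P (σ k)).prod (Q (σ k))) (X := fun k => Gb (σ k))
        (fun h => ⟨_, tendsto_meanSeminorm_of_joint hLw (hj' σ hσ) h⟩) f

/-- The data `X n` live on `(Ω n, P n)` and one copy of the bootstrap variables `V n` lives on
`(Ω' n, Q n)`. The data and two independent copies of `V n`, jointly independent, are realised on
the product space `Ω n × Ω' n × Ω' n`: at `(ω, ω₁, ω₂)` they are `X n ω`, `V n ω₁`, `V n ω₂`.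
With `G n` and `Gb n` the statistics, `𝔾_n = G n (X n ω)` and
`𝔾_n^{(j)} = Gb n (X n ω) (V n ω_j)`. The conditional (outer) expectation given the data is the
outer expectation over `ω₁` for fixed `ω`. -/
theorem mainTheorem9 {T : Type*} {Ω Ω' 𝒳 𝒱 : ℕ → Type*}
    [∀ n, MeasurableSpace (Ω n)] [∀ n, MeasurableSpace (Ω' n)]
    [∀ n, MeasurableSpace (𝒳 n)] [∀ n, MeasurableSpace (𝒱 n)]
    (P : ∀ n, Measure (Ω n)) [∀ n, IsProbabilityMeasure (P n)]
    (Q : ∀ n, Measure (Ω' n)) [∀ n, IsProbabilityMeasure (Q n)]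
    (X : ∀ n, Ω n → 𝒳 n) (hX : ∀ n, Measurable (X n))
    (V : ∀ n, Ω' n → 𝒱 n) (hV : ∀ n, Measurable (V n))
    (G : ∀ n, 𝒳 n → LInf T) (Gb : ∀ n, 𝒳 n → 𝒱 n → LInf T)
    (hG : ∀ n (t : T), Measurable (fun ω : Ω n => G n (X n ω) t))
    (hGb : ∀ n (t : T), Measurable (fun p : Ω n × Ω' n => Gb n (X n p.1) (V n p.2) t))
    (hrc : RelativelyCompact P (fun n ω => G n (X n ω))) :
    (TendstoZeroInOuterProb P
        (fun n ω => boundedLipschitzDist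
          (Q n) (fun ω₁ => Gb n (X n ω) (V n ω₁))
          (P n) (fun ω₀ => G n (X n ω₀))) ∧
      AsymptoticallyMeasurable (fun n => (P n).prod (Q n))
        (fun n p => Gb n (X n p.1) (V n p.2)))
    ↔
    RelativelyWeaklyConvergent
      (fun n => (P n).prod ((Q n).prod (Q n)))
      (fun n p => (G n (X n p.1), Gb n (X n p.1) (V n p.2.1), Gb n (X n p.1) (V n p.2.2)))
      (fun n => (P n).prod ((P n).prod (P n)))
      (fun n p => (G n (X n p.1), G n (X n p.2.1), G n (X n p.2.2))) :=
  mainTheorem9_general P Q (fun n ω => G n (X n ω)) (fun n p => Gb n (X n p.1) (V n p.2)) hrc
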